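/- Let $(\mathsf Y,\mathcal Y)$ be a measurable space and $P$ a Markov transition kernel on it. For a probability measure $\mu$ on $\mathsf Y$, let $\mathbb P_\mu$ (with expectation $\mathbb E_\mu$) be the law of the Markov chain $(Y_n)_{n\ge 0}$ with initial distribution $\mu$ and transition kernel $P$, and let $\mu P^k$ be the law of $Y_k$ under $\mathbb P_\mu$. Assume that $P$ is positive Harris recurrent (there is a nonzero $\sigma$-finite measure $\varphi$ such that, from every starting point, the chain almost surely visits every set $A$ with $\varphi(A)>0$ infinitely often, and $P$ has an invariant probability measure) with a unique stationary distribution $\pi$. Assume moreover that there are a measurable $V:\mathsf Y\to[1,\infty)$ with $\pi(V)<\infty$ and a nonnegative non-increasing sequence $(\rho(k))_{k\ge0}$ with $\rho(k)\to 0$ such that, for all probability measures $\mu,\mu'$ on $\mathsf Y$ and all integers $k\ge 0$, $$\|\mu P^k-\mu'P^k\|_{\mathrm{TV}}\le \rho(k)\,[\mu(V)+\mu'(V)],$$ where $\|\nu-\nu'\|_{\mathrm{TV}}=\sup\{|\nu(f)-\nu'(f)| : f \text{ measurable},\ |f|\le 1\}$. Assume finally that $\rho(n)=O(n^{-r})$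 for some $r>1$. Let $m\ge1$ and let $h:\mathsf Y^m\to\mathbb R$ be measurable and symmetric (invariant under permutations of its arguments) such that, for some $\delta>0$, $$\sup_{(y_1,\dots,y_m)\in\mathsf Y^m}\frac{|h(y_1,\dots,y_m)|\,(\log^+|h(y_1,\dots,y_m)|)^{1+\delta}}{\sum_{i=1}^m V(y_i)}<\infty .$$ Then, for every probability measure $\mu$ on $\mathsf Y$ with $M(\mu,V):=\sup_{k\ge0}\mu P^k(V)<\infty$, the variables $h(Y_{i_1},\dots,Y_{i_m})$, $1\le i_1<\dots<i_m$, are $\mathbb P_\mu$-integrable, $h$ is $\pi^{\otimes m}$-integrable, and, as $n\to\infty$, $$\binom nm^{-1}\sum_{1\le i_1<\dots<i_m\le n}\bigl\{h(Y_{i_1},\dots,Y_{i_m})-\mathbb E_\mu[h(Y_{i_1},\dots,Y_{i_m})]\bigr\}\longrightarrow 0\qquad \mathbb P_\mu\text{-a.s.}$$ and $$\binom nm^{-1}\sum_{1\le i_1<\dots<i_m\le n}\mathbb E_\mu[h(Y_{i_1},\dots,Y_{i_m})]\longrightarrow\int \pi(\mathrm dy_1)\cdots\pi(\mathrm dy_m)\,h(y_1,\dots,y_m).$$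 -/

import Mathlib

open MeasureTheory ProbabilityTheory Filter Topology
open scoped ENNReal

namespace UStatMarkov

noncomputable section

/-- The law `ℙ_μ` on `ℕ → Y` of the (canonical) Markov chain `(Y_n)_{n ≥ 0}` with initial
distribution `μ` and transition kernel `P`; `Y_n` is the `n`-th coordinate map. -/
def chainLaw {Y : Type*} [MeasurableSpace Y] (P : Kernel Y Y) [IsMarkovKernel P]
    (μ : Measure Y) : Measure (ℕ → Y) :=
  Kernel.trajMeasure (X := fun _ => Y) μ
    (fun n => P.comap (fun x : (i : Finset.Iic n) → Y => x ⟨n, Finset.mem_Iic.2 le_rfl⟩)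
      (measurable_pi_apply _))

/-- `μ P^k`, the law at time `k` of the chain started from `μ`. -/
def lawAt {Y : Type*} [MeasurableSpace Y] (P : Kernel Y Y) (μ : Measure Y) (k : ℕ) : Measure Y :=
  μ.bind (P ^ k : Kernel Y Y)

/-- The total variation norm `‖μ - ν‖ = sup {|μ(f) - ν(f)| : f measurable, |f| ≤ 1}` of the
difference of two finite measures. -/
def tvNorm {Y : Type*} [MeasurableSpace Y] (μ ν : Measure Y) : ℝ≥0∞ :=
  ⨆ (f : Y → ℝ) (_ : Measurable f) (_ : ∀ y, |f y| ≤ 1),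
    ENNReal.ofReal |∫ y, f y ∂μ - ∫ y, f y ∂ν|

/-- `μ(V) ∈ [0, ∞]` for a nonnegative function `V`. -/
def vMoment {Y : Type*} [MeasurableSpace Y] (μ : Measure Y) (V : Y → ℝ) : ℝ≥0∞ :=
  ∫⁻ y, ENNReal.ofReal (V y) ∂μ

/-- `M(μ, V) = sup_{k ≥ 0} μ P^k (V) ∈ [0, ∞]`. -/
def supMoment {Y : Type*} [MeasurableSpace Y] (P : Kernel Y Y) (μ : Measure Y) (V : Y → ℝ) :
    ℝ≥0∞ :=
  ⨆ k : ℕ, vMoment (lawAt P μ k) V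

/-- Harris recurrence: there is a nontrivial σ-finite measure `φ` such that, from every starting
point, the chain almost surely visits every set of positive `φ`-measure infinitely often. -/
def IsHarrisRecurrent {Y : Type*} [MeasurableSpace Y] (P : Kernel Y Y) [IsMarkovKernel P] :
    Prop :=
  ∃ φ : Measure Y, SigmaFinite φ ∧ φ ≠ 0 ∧
    ∀ A : Set Y, MeasurableSet A → 0 < φ A →
      ∀ x : Y, ∀ᵐ ω ∂(chainLaw P (Measure.dirac x)), ∃ᶠ n in atTop, ω n ∈ A

/-- Positive Harris recurrence: Harris recurrence and existence of an invariant probability. -/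
def IsPositiveHarrisRecurrent {Y : Type*} [MeasurableSpace Y] (P : Kernel Y Y)
    [IsMarkovKernel P] : Prop :=
  IsHarrisRecurrent P ∧ ∃ π : Measure Y, IsProbabilityMeasure π ∧ Kernel.Invariant P π

/-- The ergodicity assumption on the kernel `P`, with stationary distribution `π`,
function `V` and rate `ρ`. -/
structure ErgodicityAssumption {Y : Type*} [MeasurableSpace Y] (P : Kernel Y Y)
    [IsMarkovKernel P] (π : Measure Y) (V : Y → ℝ) (ρ : ℕ → ℝ) : Prop where
  positiveHarris : IsPositiveHarrisRecurrent P
  isProbabilityMeasure : IsProbabilityMeasure π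
  invariant : Kernel.Invariant P π
  unique : ∀ π' : Measure Y, IsProbabilityMeasure π' → Kernel.Invariant P π' → π' = π
  measurable_V : Measurable V
  one_le_V : ∀ y, 1 ≤ V y
  rho_nonneg : ∀ k, 0 ≤ ρ k
  rho_antitone : Antitone ρ
  rho_tendsto : Tendsto ρ atTop (𝓝 0)
  contraction : ∀ μ μ' : Measure Y, IsProbabilityMeasure μ → IsProbabilityMeasure μ' →
    ∀ k : ℕ, tvNorm (lawAt P μ k) (lawAt P μ' k) ≤
      ENNReal.ofReal (ρ k) * (vMoment μ V + vMoment μ' V)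
  moment_pi : vMoment π V < ∞

/-- `h : Y^m → ℝ` is invariant under permutations of its arguments. -/
def IsSymmetric {Y : Type*} {m : ℕ} (h : (Fin m → Y) → ℝ) : Prop :=
  ∀ (σ : Equiv.Perm (Fin m)) (y : Fin m → Y), h (fun j => y (σ j)) = h y

/-- The index tuples `1 ≤ i_1 < ⋯ < i_m ≤ n`. -/
def tuples (m n : ℕ) : Finset (Fin m → ℕ) :=
  (Fintype.piFinset fun _ : Fin m => Finset.Icc 1 n).filter fun i => ∀ a b, a < b → i a < i b

end

end UStatMarkov

open UStatMarkov

/-!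
Ergodicity at a polynomial rate makes coordinates of the chain at times separated by gaps of length
`L` decouple: their joint law is within `O(ρ L)` of a product of copies of `π` in total variation.
All but a fraction `O(L / n)` of the tuples in `{1, …, n}^{2m}` are separated in this way, so for a
kernel with `|g| ≤ T` and `π^{⊗m}(g) = 0` the second moment of the sum over index tuples is
`O(T² n^{2m} n^{-2s})` for some `s > 0`.

For `h ≥ 0`, truncate `h` at level `T`: the remainder costs `O((log T)^{-1-δ})` in mean. Along
`N_k = ⌊γ^k⌋` and with `T_k` a small power of `N_k` both errors are summable, because
`(log T_k)^{-1-δ}` is of order `k^{-1-δ}`; hence convergence along `N_k`. Since the sums increase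
with `n`, letting `γ ↓ 1` fills the gaps, and signed kernels are differences of nonnegative ones.
-/

open scoped NNReal

namespace UStatMarkov

section TotalVariation

variable {α β : Type*} [MeasurableSpace α] [MeasurableSpace β]

lemma abs_integral_le_of_abs_le {μ : Measure α} [IsProbabilityMeasure μ] {f : α → ℝ} {C : ℝ}
    (hf : ∀ x, |f x| ≤ C) : |∫ x, f x ∂μ| ≤ C := by
  simpa using norm_integral_le_of_norm_le_const (μ := μ) (f := f) (C := C) (.of_forall hf)

lemma ofReal_abs_integral_sub_le_tvNorm (μ ν : Measure α) {f : α → ℝ} (hf : Measurable f)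
    (h1 : ∀ x, |f x| ≤ 1) :
    ENNReal.ofReal |∫ x, f x ∂μ - ∫ x, f x ∂ν| ≤ tvNorm μ ν :=
  le_iSup_of_le f (le_iSup_of_le hf (le_iSup_of_le h1 le_rfl))

lemma abs_integral_sub_le_of_tvNorm_le {μ ν : Measure α} {c : ℝ≥0} (h : tvNorm μ ν ≤ c)
    {f : α → ℝ} (hf : Measurable f) {T : ℝ} (hT : 0 < T) (hfT : ∀ x, |f x| ≤ T) :
    |∫ x, f x ∂μ - ∫ x, f x ∂ν| ≤ T * c := by
  have hscaled := (ofReal_abs_integral_sub_le_tvNorm μ ν (f := fun x => T⁻¹ * f x) (by fun_prop)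
    fun x => by
      rw [abs_mul, abs_of_pos (inv_pos.2 hT), inv_mul_le_iff₀ hT, mul_one]
      exact hfT x).trans h
  rw [integral_const_mul, integral_const_mul, ← mul_sub, abs_mul, abs_of_pos (inv_pos.2 hT),
    ENNReal.ofReal_le_iff_le_toReal ENNReal.coe_ne_top, inv_mul_le_iff₀ hT] at hscaled
  exact hscaled

lemma tvNorm_self (μ : Measure α) : tvNorm μ μ = 0 := by
  simp [tvNorm]

lemma tvNorm_triangle (μ ν ξ : Measure α) : tvNorm μ ξ ≤ tvNorm μ ν + tvNorm ν ξ := by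
  refine iSup_le fun f => iSup₂_le fun hf h1 => ?_
  calc ENNReal.ofReal |∫ x, f x ∂μ - ∫ x, f x ∂ξ|
      ≤ ENNReal.ofReal (|∫ x, f x ∂μ - ∫ x, f x ∂ν| + |∫ x, f x ∂ν - ∫ x, f x ∂ξ|) :=
        ENNReal.ofReal_le_ofReal (abs_sub_le _ _ _)
    _ ≤ _ := ENNReal.ofReal_add_le
    _ ≤ tvNorm μ ν + tvNorm ν ξ := add_le_add (ofReal_abs_integral_sub_le_tvNorm μ ν hf h1)
        (ofReal_abs_integral_sub_le_tvNorm ν ξ hf h1)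

lemma tvNorm_map_le (μ ν : Measure α) {g : α → β} (hg : Measurable g) :
    tvNorm (μ.map g) (ν.map g) ≤ tvNorm μ ν := by
  refine iSup_le fun f => iSup₂_le fun hf h1 => ?_
  rw [integral_map hg.aemeasurable hf.aestronglyMeasurable,
    integral_map hg.aemeasurable hf.aestronglyMeasurable]
  exact ofReal_abs_integral_sub_le_tvNorm μ ν (hf.comp hg) fun x => h1 (g x)

lemma tvNorm_prod_le (μ ν : Measure α) [IsFiniteMeasure μ] [IsFiniteMeasure ν] (π : Measure β)
    [IsProbabilityMeasure π] : tvNorm (μ.prod π) (ν.prod π) ≤ tvNorm μ ν := by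
  refine iSup_le fun f => iSup₂_le fun hf h1 => ?_
  have hint (ξ : Measure α) [IsFiniteMeasure ξ] : Integrable f (ξ.prod π) :=
    .of_bound hf.aestronglyMeasurable 1 (.of_forall h1)
  rw [integral_prod _ (hint μ), integral_prod _ (hint ν)]
  refine ofReal_abs_integral_sub_le_tvNorm μ ν
    hf.stronglyMeasurable.integral_prod_right'.measurable fun x =>
      abs_integral_le_of_abs_le fun y => h1 (x, y)

lemma tvNorm_compProd_prod_le (μ : Measure α) [IsFiniteMeasure μ] (κ : Kernel α β)
    [IsMarkovKernel κ] (π : Measure β) [IsProbabilityMeasure π] {c : α → ℝ≥0∞}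
    (hc : ∀ x, tvNorm (κ x) π ≤ c x) : tvNorm (μ ⊗ₘ κ) (μ.prod π) ≤ ∫⁻ x, c x ∂μ := by
  refine iSup_le fun f => iSup₂_le fun hf h1 => ?_
  have hint (ξ : Measure (α × β)) [IsFiniteMeasure ξ] : Integrable f ξ :=
    .of_bound hf.aestronglyMeasurable 1 (.of_forall h1)
  have hsection : Integrable (fun x => ∫ y, f (x, y) ∂κ x) μ :=
    .of_bound hf.stronglyMeasurable.integral_kernel_prod_right'.aestronglyMeasurable 1
      (.of_forall fun x => abs_integral_le_of_abs_le fun y => h1 (x, y))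
  rw [Measure.integral_compProd (hint _), integral_prod _ (hint _),
    ← integral_sub hsection (hint _).integral_prod_left, ← Real.enorm_eq_ofReal_abs]
  refine (enorm_integral_le_lintegral_enorm _).trans (lintegral_mono fun x => ?_)
  rw [Real.enorm_eq_ofReal_abs]
  exact (ofReal_abs_integral_sub_le_tvNorm (κ x) π (hf.comp measurable_prodMk_left)
    fun y => h1 (x, y)).trans (hc x)

end TotalVariation

section Chain

variable {Y : Type*} [MeasurableSpace Y]

instance isMarkovKernel_pow (P : Kernel Y Y) [IsMarkovKernel P] (k : ℕ) :
    IsMarkovKernel (P ^ k) := by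
  induction k with
  | zero => rw [pow_zero]; exact inferInstanceAs (IsMarkovKernel Kernel.id)
  | succ k ih => rw [pow_succ]; exact inferInstanceAs (IsMarkovKernel ((P ^ k) ∘ₖ P))

lemma lawAt_dirac (P : Kernel Y Y) (x : Y) (k : ℕ) : lawAt P (Measure.dirac x) k = (P ^ k) x := by
  rw [lawAt, Measure.dirac_bind (Kernel.measurable _)]

lemma lawAt_of_invariant (P : Kernel Y Y) {π : Measure Y} (hπ : Kernel.Invariant P π) (k : ℕ) :
    lawAt P π k = π := by
  induction k with
  | zero => rw [lawAt, pow_zero]; exact Measure.id_comp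
  | succ k ih => rw [lawAt, pow_succ']; exact Kernel.Invariant.comp hπ ih

lemma ErgodicityAssumption.tvNorm_pow_le {P : Kernel Y Y} [IsMarkovKernel P] {π : Measure Y}
    {V : Y → ℝ} {ρ : ℕ → ℝ} (hA : ErgodicityAssumption P π V ρ) (x : Y) (k : ℕ) :
    tvNorm ((P ^ k) x) π ≤
      ENNReal.ofReal ((1 + (vMoment π V).toReal) * ρ k) * ENNReal.ofReal (V x) := by
  have hV1 : (1 : ℝ≥0∞) ≤ ENNReal.ofReal (V x) := ENNReal.one_le_ofReal.2 (hA.one_le_V x)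
  have hcontr := hA.contraction (Measure.dirac x) π inferInstance hA.isProbabilityMeasure k
  rw [lawAt_dirac, lawAt_of_invariant P hA.invariant, vMoment,
    lintegral_dirac' _ hA.measurable_V.ennreal_ofReal] at hcontr
  calc tvNorm ((P ^ k) x) π
      ≤ ENNReal.ofReal (ρ k) * (ENNReal.ofReal (V x) + vMoment π V * ENNReal.ofReal (V x)) :=
        hcontr.trans (by gcongr; exact le_mul_of_one_le_right' hV1)
    _ = ENNReal.ofReal ((1 + (vMoment π V).toReal) * ρ k) * ENNReal.ofReal (V x) := by
        rw [ENNReal.ofReal_mul (by positivity), ENNReal.ofReal_add zero_le_one (by positivity),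
          ENNReal.ofReal_one, ENNReal.ofReal_toReal hA.moment_pi.ne]
        ring

variable (P : Kernel Y Y) [IsMarkovKernel P] (μ : Measure Y)

lemma chainLaw_map_zero : (chainLaw P μ).map (fun ω => ω 0) = μ := by
  have hev : (fun ω : ℕ → Y => ω 0) =
      (fun u : (i : Finset.Iic 0) → Y => u ⟨0, Finset.mem_Iic.2 le_rfl⟩) ∘
        (Preorder.frestrictLe (π := fun _ => Y) 0) := rfl
  rw [hev, ← Measure.map_map (measurable_pi_apply _) (by fun_prop), chainLaw,
    Kernel.trajMeasure, Measure.map_comp _ _ (by fun_prop), Kernel.traj_map_frestrictLe,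
    Kernel.partialTraj_self, Measure.id_comp, Measure.map_map (measurable_pi_apply _) (by fun_prop)]
  exact Measure.map_id

variable [IsProbabilityMeasure μ]

instance isProbabilityMeasure_chainLaw : IsProbabilityMeasure (chainLaw P μ) := by
  unfold chainLaw; infer_instance

lemma lintegral_chainLaw_succ (n : ℕ) {f : ((i : Finset.Iic n) → Y) × Y → ℝ≥0∞}
    (hf : Measurable f) :
    ∫⁻ ω, f (Preorder.frestrictLe (π := fun _ => Y) n ω, ω (n + 1)) ∂(chainLaw P μ) =
      ∫⁻ ω, ∫⁻ y, f (Preorder.frestrictLe (π := fun _ => Y) n ω, y) ∂(P (ω n))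
        ∂(chainLaw P μ) := by
  have hstep := congrArg (fun ν => ∫⁻ x, f x ∂ν)
    (Kernel.map_frestrictLe_trajMeasure_compProd_eq_map_trajMeasure (X := fun _ => Y)
      (μ₀ := μ) (κ := fun n => P.comap (fun x : (i : Finset.Iic n) → Y =>
        x ⟨n, Finset.mem_Iic.2 le_rfl⟩) (measurable_pi_apply _)) (a := n))
  rw [Measure.lintegral_compProd hf, lintegral_map hf (by fun_prop),
    lintegral_map (Measurable.lintegral_kernel_prod_right' hf) (by fun_prop)] at hstep
  exact hstep.symm

lemma lintegral_chainLaw_add (s k : ℕ) {f : ((i : Finset.Iic s) → Y) × Y → ℝ≥0∞}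
    (hf : Measurable f) :
    ∫⁻ ω, f (Preorder.frestrictLe (π := fun _ => Y) s ω, ω (s + k)) ∂(chainLaw P μ) =
      ∫⁻ ω, ∫⁻ y, f (Preorder.frestrictLe (π := fun _ => Y) s ω, y) ∂((P ^ k) (ω s))
        ∂(chainLaw P μ) := by
  induction k generalizing f with
  | zero =>
    refine lintegral_congr fun ω => ?_
    rw [pow_zero]
    change _ = ∫⁻ y, _ ∂(Kernel.id (ω s))
    rw [Kernel.id_apply, lintegral_dirac' _ (by fun_prop), add_zero]
  | succ k ih =>
    have hlast := lintegral_chainLaw_succ P μ (s + k)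
      (f := fun p => f (Preorder.frestrictLe₂ (π := fun _ => Y) (Nat.le_add_right s k) p.1, p.2))
      (hf.comp (((Preorder.measurable_frestrictLe₂ (X := fun _ => Y) _).comp
        measurable_fst).prodMk measurable_snd))
    have hprev := ih (f := fun p => ∫⁻ y, f (p.1, y) ∂(P p.2))
      (Measurable.lintegral_kernel_prod_right' (κ := P.comap Prod.snd measurable_snd)
        (f := fun q : (((i : Finset.Iic s) → Y) × Y) × Y => f (q.1.1, q.2)) (by fun_prop))
    refine (hlast.trans hprev).trans (lintegral_congr fun ω => ?_)
    rw [pow_succ']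
    change _ = ∫⁻ y, _ ∂((P ∘ₖ (P ^ k)) (ω s))
    rw [Kernel.lintegral_comp _ _ _ (by fun_prop)]

lemma chainLaw_map_eval (k : ℕ) : (chainLaw P μ).map (fun ω => ω k) = lawAt P μ k := by
  refine Measure.ext_of_lintegral _ fun f hf => ?_
  have hmarkov := lintegral_chainLaw_add P μ 0 k (f := fun p => f p.2) (by fun_prop)
  rw [zero_add] at hmarkov
  rw [lintegral_map hf (by fun_prop), hmarkov, lawAt,
    Measure.lintegral_bind (by fun_prop) hf.aemeasurable]
  conv_rhs => rw [← chainLaw_map_zero P μ]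
  rw [lintegral_map hf.lintegral_kernel (by fun_prop)]

lemma chainLaw_map_frestrictLe_prodMk (s k : ℕ) :
    (chainLaw P μ).map (fun ω => (Preorder.frestrictLe (π := fun _ => Y) s ω, ω (s + k))) =
      ((chainLaw P μ).map (Preorder.frestrictLe (π := fun _ => Y) s)) ⊗ₘ
        ((P ^ k).comap (fun x : (i : Finset.Iic s) → Y => x ⟨s, Finset.mem_Iic.2 le_rfl⟩)
          (measurable_pi_apply _)) := by
  refine Measure.ext_of_lintegral _ fun f hf => ?_
  rw [lintegral_map hf (by fun_prop), lintegral_chainLaw_add P μ s k hf,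
    Measure.lintegral_compProd hf,
    lintegral_map (Measurable.lintegral_kernel_prod_right' hf) (by fun_prop)]
  rfl

variable {P} {V : Y → ℝ}

lemma lintegral_chainLaw_eval_le (hV : Measurable V) (k : ℕ) :
    ∫⁻ ω, ENNReal.ofReal (V (ω k)) ∂(chainLaw P μ) ≤ supMoment P μ V := by
  rw [← lintegral_map (μ := chainLaw P μ) (f := fun y => ENNReal.ofReal (V y))
    hV.ennreal_ofReal (measurable_pi_apply k), chainLaw_map_eval]
  exact le_iSup (fun k => vMoment (lawAt P μ k) V) k

end Chain

section Decoupling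

/-- The times `i a`, `a : ι`, are separated with gap `L`: they are at distance at least `L` from
one another and from the origin. No order of the times is prescribed. -/
def IsSeparated {ι : Type*} (L : ℕ) (i : ι → ℕ) : Prop :=
  (∀ a, L ≤ i a) ∧ Pairwise fun a b => i a + L ≤ i b ∨ i b + L ≤ i a

/-- The process law `ν` decouples at rate `ε` towards `π`: its marginal at `p` times separated
with gap `L` is within `p * ε L` of `π^{⊗p}` in total variation. -/
def DecouplesAtRate {Y : Type*} [MeasurableSpace Y] (ν : Measure (ℕ → Y)) (π : Measure Y)
    (ε : ℕ → ℝ≥0) : Prop :=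
  ∀ (ι : Type) [Fintype ι] (L : ℕ) (i : ι → ℕ), IsSeparated L i →
    tvNorm (ν.map fun ω a => ω (i a)) (Measure.pi fun _ : ι => π) ≤ Fintype.card ι * ε L

lemma IsSeparated.comp_injective {ι κ : Type*} {L : ℕ} {i : ι → ℕ} (hi : IsSeparated L i)
    {e : κ → ι} (he : e.Injective) : IsSeparated L (i ∘ e) :=
  ⟨fun a => hi.1 (e a), fun _ _ hab => hi.2 (he.ne hab)⟩

lemma IsSeparated.exists_forall_succAbove_le {p L : ℕ} {i : Fin (p + 1) → ℕ}
    (hi : IsSeparated L i) : ∃ a s, i a = s + L ∧ ∀ b, i (a.succAbove b) ≤ s := by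
  obtain ⟨a, ha⟩ := Finite.exists_max i
  refine ⟨a, i a - L, (Nat.sub_add_cancel (hi.1 a)).symm, fun b => ?_⟩
  have hgap := hi.2 (a.succAbove_ne b)
  have hmax := ha (a.succAbove b)
  omega

variable {Y : Type*} [MeasurableSpace Y]

lemma measurePreserving_insertNth (π : Measure Y) [IsProbabilityMeasure π] {p : ℕ}
    (a : Fin (p + 1)) :
    MeasurePreserving (fun z : (Fin p → Y) × Y => (a.insertNth z.2 z.1 : Fin (p + 1) → Y))
      ((Measure.pi fun _ => π).prod π) (Measure.pi fun _ => π) :=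
  (measurePreserving_piFinSuccAbove (fun _ => π) a).symm.comp Measure.measurePreserving_swap

lemma measurePreserving_comp_equiv (π : Measure Y) [IsProbabilityMeasure π] {ι κ : Type*}
    [Fintype ι] [Fintype κ] (e : ι ≃ κ) :
    MeasurePreserving (fun z : κ → Y => z ∘ e) (Measure.pi fun _ => π) (Measure.pi fun _ => π) :=
  by
  convert measurePreserving_piCongrLeft (fun _ : ι => π) e.symm using 1
  ext z a
  simp [MeasurableEquiv.piCongrLeft, Equiv.piCongrLeft_apply]

variable {P : Kernel Y Y} [IsMarkovKernel P] {μ : Measure Y} [IsProbabilityMeasure μ]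
  {π : Measure Y} [IsProbabilityMeasure π] {V : Y → ℝ} {ρ : ℕ → ℝ}

lemma tvNorm_chainLaw_map_prodMk_le {β : Type*} [MeasurableSpace β] (hV : Measurable V)
    (hP : ∀ x k, tvNorm ((P ^ k) x) π ≤ ENNReal.ofReal (ρ k) * ENNReal.ofReal (V x)) (s k : ℕ)
    {g : ((i : Finset.Iic s) → Y) → β} (hg : Measurable g) :
    tvNorm ((chainLaw P μ).map fun ω => (g (Preorder.frestrictLe (π := fun _ => Y) s ω), ω (s + k)))
        (((chainLaw P μ).map fun ω => g (Preorder.frestrictLe (π := fun _ => Y) s ω)).prod π) ≤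
      ENNReal.ofReal (ρ k) * supMoment P μ V := by
  set past := (chainLaw P μ).map (Preorder.frestrictLe (π := fun _ => Y) s)
  have : IsProbabilityMeasure past := Measure.isProbabilityMeasure_map (by fun_prop)
  set κ := (P ^ k).comap (fun x : (i : Finset.Iic s) → Y => x ⟨s, Finset.mem_Iic.2 le_rfl⟩)
    (measurable_pi_apply _)
  have hjoint : (chainLaw P μ).map
      (fun ω => (g (Preorder.frestrictLe (π := fun _ => Y) s ω), ω (s + k))) =
      (past ⊗ₘ κ).map (Prod.map g id) := by
    rw [← chainLaw_map_frestrictLe_prodMk, Measure.map_map (by fun_prop) (by fun_prop)]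
    rfl
  have hprod : ((chainLaw P μ).map fun ω =>
      g (Preorder.frestrictLe (π := fun _ => Y) s ω)).prod π =
      (past.prod π).map (Prod.map g id) := by
    rw [← Measure.map_prod_map _ _ hg measurable_id, Measure.map_id,
      Measure.map_map hg (by fun_prop)]
    rfl
  rw [hjoint, hprod]
  calc tvNorm ((past ⊗ₘ κ).map (Prod.map g id)) ((past.prod π).map (Prod.map g id))
      ≤ tvNorm (past ⊗ₘ κ) (past.prod π) := tvNorm_map_le _ _ (by fun_prop)
    _ ≤ ∫⁻ x, ENNReal.ofReal (ρ k) * ENNReal.ofReal (V (x ⟨s, Finset.mem_Iic.2 le_rfl⟩)) ∂past :=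
        tvNorm_compProd_prod_le past κ π fun x => hP _ k
    _ = ENNReal.ofReal (ρ k) * ∫⁻ ω, ENNReal.ofReal (V (ω s)) ∂(chainLaw P μ) := by
        rw [lintegral_const_mul _ (by fun_prop), lintegral_map (by fun_prop) (by fun_prop)]
        rfl
    _ ≤ ENNReal.ofReal (ρ k) * supMoment P μ V := by
        gcongr
        exact lintegral_chainLaw_eval_le μ hV s

lemma tvNorm_chainLaw_map_fin_le (hV : Measurable V)
    (hP : ∀ x k, tvNorm ((P ^ k) x) π ≤ ENNReal.ofReal (ρ k) * ENNReal.ofReal (V x))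
    (L p : ℕ) {i : Fin p → ℕ}
    (hi : IsSeparated L i) :
    tvNorm ((chainLaw P μ).map fun ω a => ω (i a)) (Measure.pi fun _ : Fin p => π) ≤
      p * (ENNReal.ofReal (ρ L) * supMoment P μ V) := by
  set c := ENNReal.ofReal (ρ L) * supMoment P μ V
  induction p with
  | zero =>
    have : IsProbabilityMeasure ((chainLaw P μ).map fun ω (a : Fin 0) => ω (i a)) :=
      Measure.isProbabilityMeasure_map (Measurable.aemeasurable (by fun_prop))
    have heq : (chainLaw P μ).map (fun ω (a : Fin 0) => ω (i a)) = Measure.pi fun _ => π :=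
      Measure.ext fun A _ => Subsingleton.set_cases (by simp only [measure_empty])
        (by simp only [measure_univ]) A
    rw [heq, tvNorm_self]
    exact zero_le
  | succ p ih =>
    obtain ⟨a, s, has, hle⟩ := hi.exists_forall_succAbove_le
    set marginal := (chainLaw P μ).map fun ω b => ω (i (a.succAbove b))
    set insert := fun z : (Fin p → Y) × Y => (a.insertNth z.2 z.1 : Fin (p + 1) → Y)
    have hinsert := measurePreserving_insertNth π a
    set joint := (chainLaw P μ).map fun ω => (fun b => ω (i (a.succAbove b)), ω (s + L))
    have hjoint : (chainLaw P μ).map (fun ω b => ω (i b)) = joint.map insert := by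
      rw [Measure.map_map hinsert.measurable (by fun_prop)]
      congr 1 with ω b
      cases b using Fin.succAboveCases a <;> simp [has]
    have hlast : tvNorm joint (marginal.prod π) ≤ c :=
      tvNorm_chainLaw_map_prodMk_le hV hP s L
        (g := fun x b => x ⟨i (a.succAbove b), Finset.mem_Iic.2 (hle b)⟩) (by fun_prop)
    have : IsProbabilityMeasure marginal :=
      Measure.isProbabilityMeasure_map (Measurable.aemeasurable (by fun_prop))
    rw [hjoint, ← hinsert.map_eq]
    calc tvNorm (joint.map insert) (((Measure.pi fun _ => π).prod π).map insert)
        ≤ tvNorm joint ((Measure.pi fun _ => π).prod π) := tvNorm_map_le _ _ hinsert.measurable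
      _ ≤ tvNorm joint (marginal.prod π) +
          tvNorm (marginal.prod π) ((Measure.pi fun _ => π).prod π) := tvNorm_triangle _ _ _
      _ ≤ c + p * c := add_le_add hlast ((tvNorm_prod_le _ _ _).trans
          (ih (hi.comp_injective a.succAbove_right_injective)))
      _ = (p + 1 : ℕ) * c := by push_cast; ring

lemma decouplesAtRate_chainLaw (hV : Measurable V) (hμ : supMoment P μ V < ∞)
    (hP : ∀ x k, tvNorm ((P ^ k) x) π ≤ ENNReal.ofReal (ρ k) * ENNReal.ofReal (V x)) :
    DecouplesAtRate (chainLaw P μ) π fun L => (ρ L).toNNReal * (supMoment P μ V).toNNReal := by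
  intro ι _ L i hi
  set e := Fintype.equivFin ι
  have he := measurePreserving_comp_equiv π e
  have hmap : (chainLaw P μ).map (fun ω a => ω (i a)) =
      ((chainLaw P μ).map fun ω a => ω (i (e.symm a))).map fun z => z ∘ e := by
    rw [Measure.map_map he.measurable (by fun_prop)]
    congr 1 with ω a
    simp
  rw [hmap, ← he.map_eq, ENNReal.coe_mul, ENNReal.coe_toNNReal hμ.ne]
  exact (tvNorm_map_le _ _ he.measurable).trans
    (tvNorm_chainLaw_map_fin_le hV hP L _ (hi.comp_injective e.symm.injective))

end Decoupling

section Counting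

lemma mem_tuples {m n : ℕ} {i : Fin m → ℕ} :
    i ∈ tuples m n ↔ (∀ a, i a ∈ Finset.Icc 1 n) ∧ StrictMono i := by
  simp only [tuples, Finset.mem_filter, Fintype.mem_piFinset, StrictMono]

lemma tuples_mono (m : ℕ) : Monotone (tuples m) := fun _ _ hn _ hi =>
  mem_tuples.2 ⟨fun a => Finset.Icc_subset_Icc_right hn ((mem_tuples.1 hi).1 a),
    (mem_tuples.1 hi).2⟩

lemma card_tuples (m n : ℕ) : (tuples m n).card = n.choose m := by
  have hcard : (Finset.powersetCard m (Finset.Icc 1 n)).card = n.choose m := by simp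
  rw [← hcard]
  refine Finset.card_bij' (fun i _ => Finset.univ.image i)
    (fun s hs => s.orderEmbOfFin (Finset.mem_powersetCard.1 hs).2) ?_ ?_ ?_ ?_
  · intro i hi
    rw [mem_tuples] at hi
    rw [Finset.mem_powersetCard, Finset.card_image_of_injective _ hi.2.injective]
    exact ⟨Finset.image_subset_iff.2 fun a _ => hi.1 a, by simp⟩
  · intro s hs
    refine mem_tuples.2 ⟨fun a => ?_, (s.orderEmbOfFin _).strictMono⟩
    exact (Finset.mem_powersetCard.1 hs).1 (Finset.orderEmbOfFin_mem _ _ a)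
  · intro i hi
    exact (Finset.orderEmbOfFin_unique _ (fun a => Finset.mem_image_of_mem _ (Finset.mem_univ a))
      (mem_tuples.1 hi).2).symm
  · intro s hs
    exact Finset.image_orderEmbOfFin_univ _ _

lemma tendsto_choose_div_pow (m : ℕ) :
    Tendsto (fun n : ℕ => (n.choose m : ℝ) / (n : ℝ) ^ m) atTop (𝓝 (m.factorial : ℝ)⁻¹) := by
  have hne : ∀ᶠ n : ℕ in atTop, (n : ℝ) ^ m / m.factorial ≠ 0 := by
    filter_upwards [eventually_gt_atTop 0] with n hn
    positivity
  have hratio := ((Asymptotics.isEquivalent_iff_tendsto_one hne).1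
    (isEquivalent_choose m)).mul_const (m.factorial : ℝ)⁻¹
  rw [one_mul] at hratio
  refine hratio.congr fun n => ?_
  have : (m.factorial : ℝ) ≠ 0 := by positivity
  simp only [Pi.div_apply]
  field_simp

variable {ι : Type*} [Fintype ι] [DecidableEq ι]

lemma card_filter_piFinset_mul_le (n c : ℕ) (a : ι) (Q : (ι → ℕ) → Prop) [DecidablePred Q]
    (hQ : ∀ k, ((Finset.Icc 1 n).filter fun v => Q (Function.update k a v)).card ≤ c) :
    ((Fintype.piFinset fun _ : ι => Finset.Icc 1 n).filter Q).card * n ≤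
      c * n ^ Fintype.card ι := by
  set forget : (ι → ℕ) → ι → ℕ := fun k => Function.update k a 1
  set S := (Fintype.piFinset fun _ : ι => Finset.Icc 1 n).filter Q
  have hfiber : ∀ z ∈ S.image forget, (S.filter fun k => forget k = z).card ≤ c := fun z _ => by
    have hrecover : ∀ k, forget k = z → Function.update z a (k a) = k := by
      rintro k rfl
      rw [Function.update_idem, Function.update_eq_self]
    refine (Finset.card_le_card_of_injOn (fun k => k a) (fun k hk => ?_)
      fun k hk k' hk' hkk' => ?_).trans (hQ z)
    · obtain ⟨hkS, hkz⟩ := Finset.mem_filter.1 hk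
      obtain ⟨hkI, hQk⟩ := Finset.mem_filter.1 hkS
      exact Finset.mem_filter.2 ⟨Fintype.mem_piFinset.1 hkI a, by rwa [hrecover k hkz]⟩
    · rw [← hrecover k (Finset.mem_filter.1 hk).2, ← hrecover k' (Finset.mem_filter.1 hk').2]
      exact congrArg (Function.update z a) hkk'
  have himage : S.image forget ⊆
      Fintype.piFinset (Function.update (fun _ => Finset.Icc 1 n) a {1}) := by
    refine Finset.image_subset_iff.2 fun k hk => Fintype.mem_piFinset.2 fun b => ?_
    rcases eq_or_ne b a with rfl | hb
    · simp [forget]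
    · simpa [forget, hb] using Fintype.mem_piFinset.1 (Finset.mem_filter.1 hk).1 b
  have hcard : (Fintype.piFinset (Function.update (fun _ : ι => Finset.Icc 1 n) a {1})).card =
      n ^ (Fintype.card ι - 1) := by
    rw [Fintype.card_piFinset, ← Finset.mul_prod_erase _ _ (Finset.mem_univ a),
      Finset.prod_congr rfl fun b hb => by rw [Function.update_of_ne (Finset.ne_of_mem_erase hb)]]
    simp
  calc S.card * n ≤ c * (S.image forget).card * n := by
        gcongr
        exact Finset.card_le_mul_card_image S c hfiber
    _ ≤ c * n ^ (Fintype.card ι - 1) * n := by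
        gcongr
        exact (Finset.card_le_card himage).trans_eq hcard
    _ = c * n ^ Fintype.card ι := by
        rw [mul_assoc, pow_sub_one_mul (Fintype.card_pos_iff.2 ⟨a⟩).ne']

lemma card_filter_lt_mul_le (n L : ℕ) (a : ι) :
    ((Fintype.piFinset fun _ : ι => Finset.Icc 1 n).filter fun k => k a < L).card * n ≤
      L * n ^ Fintype.card ι := by
  refine card_filter_piFinset_mul_le n L a _ fun k => ?_
  have hwindow : ((Finset.Icc 1 n).filter fun v => Function.update k a v a < L) ⊆
      Finset.range L := fun v hv => by
    simpa using (Finset.mem_filter.1 hv).2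
  exact (Finset.card_le_card hwindow).trans_eq (Finset.card_range L)

lemma card_filter_lt_add_mul_le (n L : ℕ) {a b : ι} (hab : a ≠ b) :
    ((Fintype.piFinset fun _ : ι => Finset.Icc 1 n).filter fun k =>
      k a < k b + L ∧ k b < k a + L).card * n ≤ 2 * L * n ^ Fintype.card ι := by
  refine card_filter_piFinset_mul_le n (2 * L) a _ fun k => ?_
  simp only [Function.update_self, Function.update_of_ne hab.symm]
  have hwindow : ((Finset.Icc 1 n).filter fun v => v < k b + L ∧ k b < v + L) ⊆
      Finset.Ico (k b + 1 - L) (k b + L) := fun v hv => by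
    have := (Finset.mem_filter.1 hv).2
    rw [Finset.mem_Ico]
    omega
  refine (Finset.card_le_card hwindow).trans ?_
  rw [Nat.card_Ico]
  omega

open Classical in
lemma card_not_isSeparated_mul_le (n L : ℕ) :
    ((Fintype.piFinset fun _ : ι => Finset.Icc 1 n).filter fun k => ¬ IsSeparated L k).card * n ≤
      2 * Fintype.card ι ^ 2 * L * n ^ Fintype.card ι := by
  set S := Fintype.piFinset fun _ : ι => Finset.Icc 1 n
  set clash : ι × ι → Finset (ι → ℕ) := fun p =>
    if p.1 = p.2 then S.filter fun k => k p.1 < L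
    else S.filter fun k => k p.1 < k p.2 + L ∧ k p.2 < k p.1 + L
  have hsub : (S.filter fun k => ¬ IsSeparated L k) ⊆ Finset.univ.biUnion clash := by
    intro k hk
    obtain ⟨hkS, hk⟩ := Finset.mem_filter.1 hk
    contrapose! hk
    have hno : ∀ p, k ∉ clash p := fun p hp =>
      hk (Finset.mem_biUnion.2 ⟨p, Finset.mem_univ p, hp⟩)
    refine ⟨fun a => ?_, fun a b hab => ?_⟩
    · simpa [clash, hkS] using hno (a, a)
    · have := hno (a, b)
      simp only [clash, if_neg hab, Finset.mem_filter, hkS, true_and] at this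
      omega
  have hclash : ∀ p, (clash p).card * n ≤ 2 * L * n ^ Fintype.card ι := fun p => by
    by_cases hp : p.1 = p.2
    · simp only [clash, if_pos hp]
      exact (card_filter_lt_mul_le n L p.1).trans (by gcongr; omega)
    · simp only [clash, if_neg hp]
      exact card_filter_lt_add_mul_le n L hp
  calc _ ≤ (∑ p, (clash p).card) * n := by
        gcongr
        exact (Finset.card_le_card hsub).trans Finset.card_biUnion_le
    _ ≤ ∑ _p : ι × ι, 2 * L * n ^ Fintype.card ι := by
        rw [Finset.sum_mul]
        exact Finset.sum_le_sum fun p _ => hclash p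
    _ = 2 * Fintype.card ι ^ 2 * L * n ^ Fintype.card ι := by
        rw [Finset.sum_const, Finset.card_univ, Fintype.card_prod, smul_eq_mul]
        ring

end Counting
section UStatistic

variable {Y : Type*}

/-- The unnormalised U-statistic `∑ h(Y_{i_1}, …, Y_{i_m})` over `1 ≤ i_1 < ⋯ < i_m ≤ n` of the
path `ω = (Y_k)_{k ≥ 0}`. -/
def uSum {m : ℕ} (h : (Fin m → Y) → ℝ) (n : ℕ) (ω : ℕ → Y) : ℝ :=
  ∑ i ∈ tuples m n, h fun j => ω (i j)

lemma uSum_sub {m : ℕ} (g h : (Fin m → Y) → ℝ) (n : ℕ) (ω : ℕ → Y) :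
    uSum (fun y => g y - h y) n ω = uSum g n ω - uSum h n ω :=
  Finset.sum_sub_distrib _ _

lemma uSum_const {m : ℕ} (c : ℝ) (n : ℕ) (ω : ℕ → Y) :
    uSum (fun _ : Fin m → Y => c) n ω = n.choose m * c := by
  rw [uSum, Finset.sum_const, card_tuples, nsmul_eq_mul]

variable [MeasurableSpace Y]

lemma measurable_uSum {m : ℕ} {h : (Fin m → Y) → ℝ} (hh : Measurable h) (n : ℕ) :
    Measurable (uSum h n) :=
  Finset.measurable_sum _ fun _ _ => hh.comp (by fun_prop)

lemma integral_pi_sum_mul {ι κ : Type*} [Fintype ι] [Fintype κ] (π : Measure Y)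
    [IsProbabilityMeasure π] (f : (ι → Y) → ℝ) (g : (κ → Y) → ℝ) :
    ∫ y, f (fun a => y (Sum.inl a)) * g (fun b => y (Sum.inr b))
      ∂(Measure.pi fun _ : ι ⊕ κ => π) =
      (∫ y, f y ∂(Measure.pi fun _ : ι => π)) * ∫ y, g y ∂(Measure.pi fun _ : κ => π) := by
  rw [← integral_prod_mul]
  exact (measurePreserving_sumPiEquivProdPi (fun _ : ι ⊕ κ => π)).integral_comp'
    (fun p : (ι → Y) × (κ → Y) => f p.1 * g p.2)

lemma sq_integral_abs_le_integral_sq {Ω : Type*} [MeasurableSpace Ω] {ν : Measure Ω}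
    [IsProbabilityMeasure ν] {X : Ω → ℝ} (hX : MemLp X 2 ν) :
    (∫ ω, |X ω| ∂ν) ^ 2 ≤ ∫ ω, X ω ^ 2 ∂ν := by
  have hvar := variance_eq_sub hX.abs
  have hnonneg := variance_nonneg |X| ν
  simp only [Pi.pow_apply, Pi.abs_apply, sq_abs] at hvar
  linarith

variable {ν : Measure (ℕ → Y)} [IsProbabilityMeasure ν] {π : Measure Y} {ε : ℕ → ℝ≥0}

lemma DecouplesAtRate.sum_abs_integral_le (hν : DecouplesAtRate ν π ε) {ι : Type} [Fintype ι]
    [DecidableEq ι] {G : (ι → Y) → ℝ} (hG : Measurable G) {T : ℝ} (hT : 0 < T)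
    (hGT : ∀ y, |G y| ≤ T)
    (hG0 : ∫ y, G y ∂(Measure.pi fun _ => π) = 0) {n : ℕ} (hn : n ≠ 0) (L : ℕ) :
    ∑ k ∈ Fintype.piFinset fun _ : ι => Finset.Icc 1 n, |∫ ω, G (fun a => ω (k a)) ∂ν| ≤
      T * n ^ Fintype.card ι * (Fintype.card ι * ε L + 2 * Fintype.card ι ^ 2 * (L / n)) := by
  classical
  set S := Fintype.piFinset fun _ : ι => Finset.Icc 1 n
  set p := Fintype.card ι
  have hcardS : (S.card : ℝ) = n ^ p := by simp [S, p]
  have hbad : ((S.filter fun k => ¬ IsSeparated L k).card : ℝ) ≤ n ^ p * (2 * p ^ 2 * (L / n)) := by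
    have hcount : ((S.filter fun k => ¬ IsSeparated L k).card : ℝ) * n ≤
        2 * p ^ 2 * L * n ^ p := by exact_mod_cast card_not_isSeparated_mul_le n L
    rw [← le_div_iff₀ (by positivity)] at hcount
    exact hcount.trans_eq (by ring)
  have hgood : ∀ k, IsSeparated L k → |∫ ω, G (fun a => ω (k a)) ∂ν| ≤ T * (p * ε L) :=
    fun k hk => by
      have hdec := abs_integral_sub_le_of_tvNorm_le (c := p * ε L)
        ((hν ι L k hk).trans_eq (by push_cast; rfl)) hG hT hGT
      rw [hG0, sub_zero, integral_map (Measurable.aemeasurable (by fun_prop))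
        hG.aestronglyMeasurable] at hdec
      simpa using hdec
  rw [← Finset.sum_filter_add_sum_filter_not S (IsSeparated L)]
  calc _ ≤ (S.filter (IsSeparated L)).card • (T * (p * ε L)) +
          (S.filter fun k => ¬ IsSeparated L k).card • T :=
        add_le_add (Finset.sum_le_card_nsmul _ _ _ fun k hk => hgood k (Finset.mem_filter.1 hk).2)
          (Finset.sum_le_card_nsmul _ _ _ fun k _ =>
            abs_integral_le_of_abs_le fun ω => hGT fun a => ω (k a))
    _ ≤ n ^ p * (T * (p * ε L)) + n ^ p * (2 * p ^ 2 * (L / n)) * T := by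
        rw [nsmul_eq_mul, nsmul_eq_mul]
        gcongr
        rw [← hcardS]
        exact_mod_cast Finset.card_le_card (Finset.filter_subset _ _)
    _ = T * n ^ p * (p * ε L + 2 * p ^ 2 * (L / n)) := by ring

variable [IsProbabilityMeasure π]

lemma DecouplesAtRate.integral_sq_uSum_le (hν : DecouplesAtRate ν π ε) {m : ℕ}
    {g : (Fin m → Y) → ℝ} (hg : Measurable g) {T : ℝ} (hT : 0 < T) (hgT : ∀ y, |g y| ≤ T)
    (hg0 : ∫ y, g y ∂(Measure.pi fun _ => π) = 0) {n : ℕ} (hn : n ≠ 0) (L : ℕ) :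
    ∫ ω, uSum g n ω ^ 2 ∂ν ≤
      T ^ 2 * n ^ (2 * m) * (2 * m * ε L + 8 * m ^ 2 * (L / n)) := by
  set G : (Fin m ⊕ Fin m → Y) → ℝ := fun y =>
    g (fun a => y (Sum.inl a)) * g (fun a => y (Sum.inr a))
  have hG : Measurable G := (hg.comp (by fun_prop)).mul (hg.comp (by fun_prop))
  have hGT : ∀ y, |G y| ≤ T ^ 2 := fun y => by
    rw [abs_mul, sq]
    exact mul_le_mul (hgT _) (hgT _) (abs_nonneg _) hT.le
  have hG0 : ∫ y, G y ∂(Measure.pi fun _ => π) = 0 := by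
    simp only [G, integral_pi_sum_mul, hg0, zero_mul]
  set E : (Fin m ⊕ Fin m → ℕ) → ℝ := fun k => ∫ ω, G (fun a => ω (k a)) ∂ν
  have hsq : ∀ ω, uSum g n ω ^ 2 =
      ∑ p ∈ tuples m n ×ˢ tuples m n, G (fun a => ω (Sum.elim p.1 p.2 a)) := fun ω => by
    rw [uSum, sq, Finset.sum_mul_sum, Finset.sum_product]
    rfl
  have hinj : Set.InjOn (fun p : (Fin m → ℕ) × (Fin m → ℕ) => Sum.elim p.1 p.2)
      (tuples m n ×ˢ tuples m n : Finset _) :=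
    (Equiv.sumArrowEquivProdArrow (Fin m) (Fin m) ℕ).symm.injective.injOn
  have himage : (tuples m n ×ˢ tuples m n).image (fun p => Sum.elim p.1 p.2) ⊆
      Fintype.piFinset fun _ : Fin m ⊕ Fin m => Finset.Icc 1 n := by
    refine Finset.image_subset_iff.2 fun p hp => Fintype.mem_piFinset.2 ?_
    obtain ⟨hp1, hp2⟩ := Finset.mem_product.1 hp
    exact Sum.forall.2 ⟨(mem_tuples.1 hp1).1, (mem_tuples.1 hp2).1⟩
  calc ∫ ω, uSum g n ω ^ 2 ∂ν
      = ∑ p ∈ tuples m n ×ˢ tuples m n, E (Sum.elim p.1 p.2) := by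
        simp only [hsq]
        exact integral_finsetSum _ fun p _ => .of_bound (hG.comp
          (f := fun (ω : ℕ → Y) a => ω (Sum.elim p.1 p.2 a)) (by fun_prop)).aestronglyMeasurable
          (T ^ 2) (.of_forall fun ω => hGT fun a => ω (Sum.elim p.1 p.2 a))
    _ = ∑ k ∈ (tuples m n ×ˢ tuples m n).image (fun p => Sum.elim p.1 p.2), E k :=
        (Finset.sum_image hinj).symm
    _ ≤ ∑ k ∈ Fintype.piFinset fun _ : Fin m ⊕ Fin m => Finset.Icc 1 n, |E k| :=
        (Finset.sum_le_sum fun k _ => le_abs_self _).trans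
          (Finset.sum_le_sum_of_subset_of_nonneg himage fun _ _ _ => abs_nonneg _)
    _ ≤ T ^ 2 * n ^ (2 * m) * (2 * m * ε L + 8 * m ^ 2 * (L / n)) :=
        (hν.sum_abs_integral_le hG (by positivity) hGT hG0 hn L).trans_eq (by
          rw [Fintype.card_sum, Fintype.card_fin, ← two_mul]
          push_cast
          ring)

lemma exists_gap_of_isBigO {r : ℝ} (hr : 0 < r)
    (hε : (fun k => (ε k : ℝ)) =O[atTop] fun n : ℕ => (n : ℝ) ^ (-r)) :
    ∃ s > (0 : ℝ), ∃ C ≥ (0 : ℝ), ∀ n : ℕ, n ≠ 0 →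
      ∃ L : ℕ, (ε L + L / n : ℝ) ≤ C * ((n : ℝ) ^ (-s)) ^ 2 := by
  obtain ⟨C, hC, hεC⟩ := Asymptotics.bound_of_isBigO_nat_atTop hε
  set s := min r 1 / 4
  refine ⟨s, by positivity, C + 2, by positivity, fun n hn => ⟨⌈√n⌉₊, ?_⟩⟩
  have hn1 : (1 : ℝ) ≤ n := Nat.one_le_cast.2 (Nat.one_le_iff_ne_zero.2 hn)
  have hsqrt : √(n : ℝ) = (n : ℝ) ^ (2⁻¹ : ℝ) := by rw [Real.sqrt_eq_rpow, one_div]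
  have hL : √(n : ℝ) ≤ ⌈√(n : ℝ)⌉₊ := Nat.le_ceil _
  have hpow : ((n : ℝ) ^ (-s)) ^ 2 = (n : ℝ) ^ (-(2 * s)) := by
    rw [← Real.rpow_mul_natCast (by positivity)]
    ring_nf
  have hdecay : (ε ⌈√(n : ℝ)⌉₊ : ℝ) ≤ C * (n : ℝ) ^ (-(2 * s)) := by
    have hbound := hεC (x := ⌈√(n : ℝ)⌉₊) (by positivity)
    rw [Real.norm_of_nonneg (by positivity), Real.norm_of_nonneg (by positivity)] at hbound
    refine hbound.trans (mul_le_mul_of_nonneg_left ?_ hC.le)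
    calc (⌈√(n : ℝ)⌉₊ : ℝ) ^ (-r) ≤ √(n : ℝ) ^ (-r) :=
          Real.rpow_le_rpow_of_nonpos (by positivity) hL (by linarith)
      _ = (n : ℝ) ^ (2⁻¹ * -r) := by rw [hsqrt, Real.rpow_mul (by positivity)]
      _ ≤ (n : ℝ) ^ (-(2 * s)) :=
          Real.rpow_le_rpow_of_exponent_le hn1 (by
            have := min_le_left r 1
            simp only [s]
            linarith)
  have hgap : (⌈√(n : ℝ)⌉₊ : ℝ) / n ≤ 2 * (n : ℝ) ^ (-(2 * s)) := by
    have hceil : (⌈√(n : ℝ)⌉₊ : ℝ) ≤ 2 * √n := by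
      have := Nat.ceil_lt_add_one (Real.sqrt_nonneg n)
      have := Real.one_le_sqrt.2 hn1
      linarith
    calc (⌈√(n : ℝ)⌉₊ : ℝ) / n ≤ 2 * √n / n := by gcongr
      _ = 2 * (n : ℝ) ^ (-2⁻¹ : ℝ) := by
          rw [mul_div_assoc, Real.sqrt_div_self', hsqrt, one_div, ← Real.rpow_neg (by positivity)]
      _ ≤ 2 * (n : ℝ) ^ (-(2 * s)) := by
          gcongr
          have := min_le_right r 1
          simp only [s]
          linarith
  rw [hpow, add_mul]
  exact add_le_add hdecay hgap

lemma DecouplesAtRate.exists_integral_abs_uSum_le (hν : DecouplesAtRate ν π ε) {r : ℝ} (hr : 0 < r)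
    (hε : (fun k => (ε k : ℝ)) =O[atTop] fun n : ℕ => (n : ℝ) ^ (-r)) (m : ℕ) :
    ∃ s > (0 : ℝ), ∃ C : ℝ, ∀ n : ℕ, n ≠ 0 → ∀ T > (0 : ℝ), ∀ g : (Fin m → Y) → ℝ,
      Measurable g → (∀ y, |g y| ≤ T) → ∫ y, g y ∂(Measure.pi fun _ => π) = 0 →
      ∫ ω, |uSum g n ω| ∂ν ≤ C * T * n ^ m * (n : ℝ) ^ (-s) := by
  obtain ⟨s, hs, C, hC, hgap⟩ := exists_gap_of_isBigO hr hε
  refine ⟨s, hs, √((2 * m + 8 * m ^ 2) * C), fun n hn T hT g hg hgT hg0 => ?_⟩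
  obtain ⟨L, hL⟩ := hgap n hn
  have hbdd : ∀ ω, ‖uSum g n ω‖ ≤ (tuples m n).card • T := fun ω =>
    (norm_sum_le _ _).trans (Finset.sum_le_card_nsmul _ _ _ fun i _ => hgT fun j => ω (i j))
  have hmemLp : MemLp (uSum g n) 2 ν :=
    .of_bound (measurable_uSum hg n).aestronglyMeasurable _ (.of_forall hbdd)
  refine le_of_sq_le_sq ?_ (by positivity)
  calc (∫ ω, |uSum g n ω| ∂ν) ^ 2 ≤ ∫ ω, uSum g n ω ^ 2 ∂ν := sq_integral_abs_le_integral_sq hmemLp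
    _ ≤ T ^ 2 * n ^ (2 * m) * (2 * m * ε L + 8 * m ^ 2 * (L / n)) :=
        hν.integral_sq_uSum_le hg hT hgT hg0 hn L
    _ ≤ T ^ 2 * n ^ (2 * m) * ((2 * m + 8 * m ^ 2) * (ε L + L / n)) := by
        gcongr
        have : (0 : ℝ) ≤ 8 * m ^ 2 * ε L + 2 * m * (L / n) := by positivity
        linarith
    _ ≤ T ^ 2 * n ^ (2 * m) * ((2 * m + 8 * m ^ 2) * (C * ((n : ℝ) ^ (-s)) ^ 2)) := by gcongr
    _ = (√((2 * m + 8 * m ^ 2) * C) * T * n ^ m * (n : ℝ) ^ (-s)) ^ 2 := by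
        rw [mul_pow, mul_pow, mul_pow, Real.sq_sqrt (by positivity)]
        ring

lemma DecouplesAtRate.exists_integral_abs_uSum_sub_le (hν : DecouplesAtRate ν π ε) {r : ℝ}
    (hr : 0 < r) (hε : (fun k => (ε k : ℝ)) =O[atTop] fun n : ℕ => (n : ℝ) ^ (-r)) (m : ℕ) :
    ∃ s > (0 : ℝ), ∃ C : ℝ, ∀ n : ℕ, n ≠ 0 → ∀ T > (0 : ℝ), ∀ g : (Fin m → Y) → ℝ,
      Measurable g → (∀ y, |g y| ≤ T) →
      ∫ ω, |uSum g n ω - n.choose m * ∫ y, g y ∂(Measure.pi fun _ => π)| ∂ν ≤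
        C * T * n ^ m * (n : ℝ) ^ (-s) := by
  obtain ⟨s, hs, C, hL1⟩ := hν.exists_integral_abs_uSum_le hr hε m
  refine ⟨s, hs, C * 2, fun n hn T hT g hg hgT => ?_⟩
  set c := ∫ y, g y ∂(Measure.pi fun _ => π)
  have hcentred : ∫ y, g y - c ∂(Measure.pi fun _ => π) = 0 := by
    rw [integral_sub (.of_bound hg.aestronglyMeasurable T (.of_forall hgT)) (integrable_const c)]
    simp [c]
  have hbdd : ∀ y, |g y - c| ≤ 2 * T := fun y => by
    have := abs_sub (g y) c
    have := abs_integral_le_of_abs_le (μ := Measure.pi fun _ => π) hgT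
    linarith [hgT y]
  simpa only [uSum_sub, uSum_const, mul_assoc] using
    hL1 n hn (2 * T) (by positivity) (fun y => g y - c) (hg.sub_const c) hbdd hcentred

end UStatistic

section LLogTruncation

/-- The function `x ↦ |x| (log⁺|x|)^{1+δ}` of the growth condition on the kernel. -/
noncomputable def llog (δ x : ℝ) : ℝ :=
  |x| * Real.posLog |x| ^ (1 + δ)

variable {δ : ℝ}

lemma llog_nonneg (x : ℝ) : 0 ≤ llog δ x :=
  mul_nonneg (abs_nonneg x) (Real.rpow_nonneg Real.posLog_nonneg _)

lemma measurable_llog : Measurable (llog δ) :=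
  measurable_id.abs.mul ((Real.continuous_posLog.measurable.comp measurable_id.abs).pow_const _)

lemma llog_le_llog (hδ : 0 < δ) {x y : ℝ} (hxy : |x| ≤ |y|) : llog δ x ≤ llog δ y := by
  have hlog := Real.posLog_le_posLog (abs_nonneg x) hxy
  have hlog0 := Real.posLog_nonneg (x := |x|)
  unfold llog
  gcongr

lemma sub_min_le_llog_div (hδ : 0 < δ) {x T : ℝ} (hx : 0 ≤ x) (hT : 1 < T) :
    x - min x T ≤ llog δ x / Real.log T ^ (1 + δ) := by
  have hlog : 0 < Real.log T := Real.log_pos hT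
  rcases le_total x T with hxT | hTx
  · rw [min_eq_left hxT, sub_self]
    exact div_nonneg (llog_nonneg x) (by positivity)
  · have hmono : Real.log T ≤ Real.posLog x :=
      (Real.log_le_log (by positivity) hTx).trans (le_max_right _ _)
    rw [min_eq_right hTx, le_div_iff₀ (by positivity), llog, abs_of_nonneg hx]
    gcongr
    linarith

variable {Ω : Type*} [MeasurableSpace Ω] {ν : Measure Ω} {X : Ω → ℝ} {M : ℝ≥0}

lemma integrable_llog (hX : Measurable X) (hM : ∫⁻ ω, ENNReal.ofReal (llog δ (X ω)) ∂ν ≤ M) :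
    Integrable (fun ω => llog δ (X ω)) ν :=
  (lintegral_ofReal_ne_top_iff_integrable (measurable_llog.comp hX).aestronglyMeasurable
    (.of_forall fun _ => llog_nonneg _)).1 (hM.trans_lt ENNReal.coe_lt_top).ne

lemma integrable_of_lintegral_llog_le [IsFiniteMeasure ν] (hδ : 0 < δ) (hX : Measurable X)
    (hM : ∫⁻ ω, ENNReal.ofReal (llog δ (X ω)) ∂ν ≤ M) : Integrable X ν := by
  refine ((integrable_const (Real.exp 1)).add (integrable_llog hX hM)).mono'
    hX.aestronglyMeasurable (.of_forall fun ω => ?_)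
  have htail := sub_min_le_llog_div hδ (abs_nonneg (X ω)) (Real.one_lt_exp_iff.2 one_pos)
  rw [Real.log_exp, Real.one_rpow, div_one, llog, abs_abs] at htail
  have htrunc := min_le_right |X ω| (Real.exp 1)
  rw [Pi.add_apply, Real.norm_eq_abs, llog]
  linarith

lemma integral_sub_min_le [IsFiniteMeasure ν] (hδ : 0 < δ) (hX : Measurable X)
    (hX0 : ∀ ω, 0 ≤ X ω) (hM : ∫⁻ ω, ENNReal.ofReal (llog δ (X ω)) ∂ν ≤ M) {T : ℝ} (hT : 1 < T) :
    ∫ ω, X ω - min (X ω) T ∂ν ≤ M / Real.log T ^ (1 + δ) := by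
  have hXi := integrable_of_lintegral_llog_le hδ hX hM
  have hlog : 0 < Real.log T := Real.log_pos hT
  calc ∫ ω, X ω - min (X ω) T ∂ν ≤ ∫ ω, llog δ (X ω) / Real.log T ^ (1 + δ) ∂ν :=
        integral_mono (hXi.sub (hXi.inf (integrable_const T)))
          ((integrable_llog hX hM).div_const _) fun ω => sub_min_le_llog_div hδ (hX0 ω) hT
    _ = (∫ ω, llog δ (X ω) ∂ν) / Real.log T ^ (1 + δ) := integral_div _ _
    _ ≤ M / Real.log T ^ (1 + δ) := by
        gcongr
        rw [integral_eq_lintegral_of_nonneg_ae (.of_forall fun _ => llog_nonneg _)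
          (measurable_llog.comp hX).aestronglyMeasurable]
        exact ENNReal.toReal_le_coe_of_le_coe hM

lemma tendsto_integral_min (hX : Integrable X ν) (hX0 : ∀ ω, 0 ≤ X ω) {T : ℕ → ℝ}
    (hT0 : ∀ k, 0 ≤ T k) (hT : Tendsto T atTop atTop) :
    Tendsto (fun k => ∫ ω, min (X ω) (T k) ∂ν) atTop (𝓝 (∫ ω, X ω ∂ν)) := by
  refine tendsto_integral_of_dominated_convergence X
    (fun k => hX.aestronglyMeasurable.inf aestronglyMeasurable_const) hX
    (fun k => .of_forall fun ω => ?_) (.of_forall fun ω => ?_)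
  · rw [Real.norm_of_nonneg (le_min (hX0 ω) (hT0 k))]
    exact min_le_left _ _
  · refine tendsto_const_nhds.congr' ?_
    filter_upwards [hT.eventually_ge_atTop (X ω)] with k hk
    rw [min_eq_left hk]

variable {Y : Type*} [MeasurableSpace Y] {m : ℕ}

/-- Uniform `L (log L)^{1+δ}` control of the kernel `h`, with constant `M`, along all tuples of
coordinates of the process law `ν` and under the product measure `π^{⊗m}`. -/
structure IsLLogBounded (ν : Measure (ℕ → Y)) (π : Measure Y) (δ : ℝ) (M : ℝ≥0)
    (h : (Fin m → Y) → ℝ) : Prop where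
  measurable : Measurable h
  lintegral_path_le : ∀ i : Fin m → ℕ,
    ∫⁻ ω, ENNReal.ofReal (llog δ (h fun j => ω (i j))) ∂ν ≤ M
  lintegral_pi_le : ∫⁻ y, ENNReal.ofReal (llog δ (h y)) ∂(Measure.pi fun _ => π) ≤ M

namespace IsLLogBounded

variable {ν : Measure (ℕ → Y)} {π : Measure Y} {g h : (Fin m → Y) → ℝ}

lemma mono (hh : IsLLogBounded ν π δ M h) (hδ : 0 < δ) (hg : Measurable g)
    (hgh : ∀ y, |g y| ≤ |h y|) : IsLLogBounded ν π δ M g where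
  measurable := hg
  lintegral_path_le i := (lintegral_mono fun _ =>
    ENNReal.ofReal_le_ofReal (llog_le_llog hδ (hgh _))).trans (hh.lintegral_path_le i)
  lintegral_pi_le := (lintegral_mono fun _ =>
    ENNReal.ofReal_le_ofReal (llog_le_llog hδ (hgh _))).trans hh.lintegral_pi_le

lemma measurable_path (hh : IsLLogBounded ν π δ M h) (i : Fin m → ℕ) :
    Measurable fun ω : ℕ → Y => h fun j => ω (i j) :=
  hh.measurable.comp (by fun_prop)

lemma integrable_path [IsFiniteMeasure ν] (hh : IsLLogBounded ν π δ M h) (hδ : 0 < δ)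
    (i : Fin m → ℕ) : Integrable (fun ω : ℕ → Y => h fun j => ω (i j)) ν :=
  integrable_of_lintegral_llog_le hδ (hh.measurable_path i) (hh.lintegral_path_le i)

lemma integrable_pi [IsFiniteMeasure π] (hh : IsLLogBounded ν π δ M h) (hδ : 0 < δ) :
    Integrable h (Measure.pi fun _ => π) :=
  integrable_of_lintegral_llog_le hδ hh.measurable hh.lintegral_pi_le

end IsLLogBounded

lemma lintegral_llog_le_of_le_sum {V : Y → ℝ} (hV : Measurable V) {h : (Fin m → Y) → ℝ} {K A : ℝ≥0}
    (hbound : ∀ y, llog δ (h y) ≤ K * ∑ j, V (y j)) {Z : Ω → Fin m → Y} (hZ : Measurable Z)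
    (hA : ∀ j, ∫⁻ ω, ENNReal.ofReal (V (Z ω j)) ∂ν ≤ A) :
    ∫⁻ ω, ENNReal.ofReal (llog δ (h (Z ω))) ∂ν ≤ ↑(K * (m * A)) := by
  calc ∫⁻ ω, ENNReal.ofReal (llog δ (h (Z ω))) ∂ν
      ≤ ∫⁻ ω, K * ∑ j, ENNReal.ofReal (V (Z ω j)) ∂ν := lintegral_mono fun ω => by
        refine (ENNReal.ofReal_le_ofReal (hbound (Z ω))).trans ?_
        rw [ENNReal.ofReal_mul K.coe_nonneg, ENNReal.ofReal_coe_nnreal]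
        gcongr
        exact Finset.le_sum_of_subadditive _ ENNReal.ofReal_zero.le
          (fun _ _ => ENNReal.ofReal_add_le) _ _
    _ = K * ∑ j, ∫⁻ ω, ENNReal.ofReal (V (Z ω j)) ∂ν := by
        rw [lintegral_const_mul _ (by fun_prop), lintegral_finsetSum _ fun j _ => by fun_prop]
    _ ≤ K * ∑ _j : Fin m, (A : ℝ≥0∞) := by gcongr with j; exact hA j
    _ = ↑(K * (m * A)) := by simp

lemma exists_isLLogBounded_chainLaw {P : Kernel Y Y} [IsMarkovKernel P] {μ π : Measure Y}
    [IsProbabilityMeasure μ] [IsProbabilityMeasure π] {V : Y → ℝ} (hV : Measurable V)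
    (hV0 : ∀ y, 0 < V y) (hπ : vMoment π V < ∞) (hμ : supMoment P μ V < ∞) (hm : 1 ≤ m)
    {h : (Fin m → Y) → ℝ} (hh : Measurable h)
    (hbound : BddAbove (Set.range fun y : Fin m → Y =>
      |h y| * (Real.posLog |h y|) ^ (1 + δ) / ∑ i, V (y i))) :
    ∃ M, IsLLogBounded (chainLaw P μ) π δ M h := by
  obtain ⟨K, hK⟩ := hbound
  have hsum : ∀ y : Fin m → Y, 0 < ∑ i, V (y i) := fun y =>
    Finset.sum_pos (fun i _ => hV0 (y i)) ⟨⟨0, hm⟩, Finset.mem_univ _⟩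
  have hllog : ∀ y, llog δ (h y) ≤ K.toNNReal * ∑ i, V (y i) := fun y =>
    (div_le_iff₀ (hsum y)).1 ((hK ⟨y, rfl⟩).trans (Real.le_coe_toNNReal K))
  lift supMoment P μ V to ℝ≥0 using hμ.ne with Aμ hAμ
  lift vMoment π V to ℝ≥0 using hπ.ne with Aπ hAπ
  refine ⟨K.toNNReal * (m * max Aμ Aπ), hh, fun i => ?_, ?_⟩
  · refine lintegral_llog_le_of_le_sum hV hllog (Z := fun (ω : ℕ → Y) j => ω (i j))
      (by fun_prop) fun j => ?_
    exact ((lintegral_chainLaw_eval_le μ hV (i j)).trans_eq hAμ.symm).trans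
      (ENNReal.coe_le_coe.2 (le_max_left _ _))
  · refine lintegral_llog_le_of_le_sum hV hllog measurable_id fun j => ?_
    have heval := (measurePreserving_eval (fun _ : Fin m => π) j).lintegral_comp hV.ennreal_ofReal
    exact (heval.trans hAπ.symm).le.trans (ENNReal.coe_le_coe.2 (le_max_right _ _))

end LLogTruncation

lemma summable_pow_mul_floor_pow_rpow {γ s : ℝ} (hγ : 1 < γ) (hs : 0 < s) :
    Summable fun k : ℕ => (γ ^ (s / 2)) ^ (k + 1) * (⌊γ ^ k⌋₊ : ℝ) ^ (-s) := by
  have hγ0 : 0 < γ := one_pos.trans hγ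
  have hq : 0 < 1 - γ⁻¹ := sub_pos.2 (inv_lt_one_of_one_lt₀ hγ)
  set τ := γ ^ (s / 2)
  have hτ : 1 < τ := Real.one_lt_rpow hγ (half_pos hs)
  have hτsq : γ ^ (-s) = τ⁻¹ ^ 2 := by
    rw [inv_pow, ← Real.rpow_mul_natCast hγ0.le, ← Real.rpow_neg hγ0.le]
    congr 1
    push_cast
    ring
  have hcancel : ∀ k : ℕ, τ ^ k * τ⁻¹ ^ k = 1 := fun k => by
    rw [← mul_pow, mul_inv_cancel₀ (one_pos.trans hτ).ne', one_pow]
  refine .of_nonneg_of_le (fun k => by positivity) (fun k => ?_)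
    ((summable_geometric_of_lt_one (by positivity) (inv_lt_one_of_one_lt₀ hτ)).mul_left
      (τ * (1 - γ⁻¹) ^ (-s)))
  calc τ ^ (k + 1) * (⌊γ ^ k⌋₊ : ℝ) ^ (-s)
      ≤ τ ^ (k + 1) * ((1 - γ⁻¹) * γ ^ k) ^ (-s) := by
        refine mul_le_mul_of_nonneg_left ?_ (by positivity)
        exact Real.rpow_le_rpow_of_nonpos (by positivity) (mul_pow_le_nat_floor_pow hγ k)
          (neg_nonpos.2 hs.le)
    _ = τ * (1 - γ⁻¹) ^ (-s) * τ⁻¹ ^ k := by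
        rw [Real.mul_rpow hq.le (by positivity), ← Real.rpow_pow_comm hγ0.le (-s), hτsq]
        linear_combination τ * (1 - γ⁻¹) ^ (-s) * τ⁻¹ ^ k * hcancel k

lemma summable_inv_log_pow_rpow {τ δ : ℝ} (hτ : 1 < τ) (hδ : 0 < δ) :
    Summable fun k : ℕ => (Real.log (τ ^ (k + 1)) ^ (1 + δ))⁻¹ := by
  have hp : Summable fun k : ℕ => 1 / ((k + 1 : ℕ) : ℝ) ^ (1 + δ) :=
    (summable_nat_add_iff 1).2 (Real.summable_one_div_nat_rpow.2 (by linarith))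
  refine (hp.mul_left (Real.log τ ^ (1 + δ))⁻¹).congr fun k => ?_
  rw [Real.log_pow, Real.mul_rpow (by positivity) (Real.log_pos hτ).le, mul_inv_rev, one_div]

section SummableDeviation

variable {Ω : Type*} [MeasurableSpace Ω] {ν : Measure Ω} [IsFiniteMeasure ν] {X : ℕ → Ω → ℝ}
  {a : ℕ → ℝ} {l : ℝ}

lemma ae_tendsto_of_summable_integral_abs_sub (hX : ∀ k, Integrable (X k) ν)
    (ha : Tendsto a atTop (𝓝 l)) (hsum : Summable fun k => ∫ ω, |X k ω - a k| ∂ν) :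
    ∀ᵐ ω ∂ν, Tendsto (fun k => X k ω) atTop (𝓝 l) := by
  have hdev : ∀ k, Integrable (fun ω => X k ω - a k) ν := fun k =>
    (hX k).sub (integrable_const _)
  have hfin : ∑' k, eLpNorm (fun ω => X k ω - a k) 1 ν ≠ ∞ := by
    simp only [eLpNorm_one_eq_lintegral_enorm, ← ofReal_integral_norm_eq_lintegral_enorm (hdev _)]
    exact hsum.tsum_ofReal_ne_top
  filter_upwards [summable_norm_of_tsum_eLpNorm_ne_top le_rfl
    (fun k => (hdev k).aestronglyMeasurable) hfin] with ω hω
  simpa using (tendsto_zero_iff_norm_tendsto_zero.2 hω.tendsto_atTop_zero).add ha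

lemma tendsto_integral_of_summable_integral_abs_sub [IsProbabilityMeasure ν]
    (hX : ∀ k, Integrable (X k) ν) (ha : Tendsto a atTop (𝓝 l))
    (hsum : Summable fun k => ∫ ω, |X k ω - a k| ∂ν) :
    Tendsto (fun k => ∫ ω, X k ω ∂ν) atTop (𝓝 l) := by
  have hdev : Tendsto (fun k => ∫ ω, X k ω ∂ν - a k) atTop (𝓝 0) := by
    refine squeeze_zero_norm (fun k => ?_) hsum.tendsto_atTop_zero
    have hmean : ∫ ω, X k ω - a k ∂ν = ∫ ω, X k ω ∂ν - a k := by
      rw [integral_sub (hX k) (integrable_const _), integral_const, probReal_univ, one_smul]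
    rw [← hmean]
    exact norm_integral_le_integral_norm _
  simpa using hdev.add ha

end SummableDeviation

section GeometricSubsequence

variable {Y : Type*} {m : ℕ}

variable [MeasurableSpace Y] {ν : Measure (ℕ → Y)}

lemma integrable_uSum {g : (Fin m → Y) → ℝ}
    (hg : ∀ i : Fin m → ℕ, Integrable (fun ω : ℕ → Y => g fun j => ω (i j)) ν) (n : ℕ) :
    Integrable (uSum g n) ν :=
  integrable_finsetSum _ fun i _ => hg i

lemma integral_uSum {g : (Fin m → Y) → ℝ}
    (hg : ∀ i : Fin m → ℕ, Integrable (fun ω : ℕ → Y => g fun j => ω (i j)) ν) (n : ℕ) :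
    ∫ ω, uSum g n ω ∂ν = ∑ i ∈ tuples m n, ∫ ω, g (fun j => ω (i j)) ∂ν :=
  integral_finsetSum _ fun i _ => hg i

lemma integral_abs_uSum_le {g : (Fin m → Y) → ℝ}
    (hg : ∀ i : Fin m → ℕ, Integrable (fun ω : ℕ → Y => g fun j => ω (i j)) ν) {B : ℝ}
    (hB : ∀ i : Fin m → ℕ, ∫ ω, |g fun j => ω (i j)| ∂ν ≤ B) (n : ℕ) :
    ∫ ω, |uSum g n ω| ∂ν ≤ n ^ m * B := by
  have hB0 : 0 ≤ B := (integral_nonneg fun _ => abs_nonneg _).trans (hB 0)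
  calc ∫ ω, |uSum g n ω| ∂ν ≤ ∫ ω, ∑ i ∈ tuples m n, |g fun j => ω (i j)| ∂ν :=
        integral_mono (integrable_uSum hg n).abs (integrable_finsetSum _ fun i _ => (hg i).abs)
          fun _ => Finset.abs_sum_le_sum_abs _ _
    _ = ∑ i ∈ tuples m n, ∫ ω, |g fun j => ω (i j)| ∂ν :=
        integral_finsetSum _ fun i _ => (hg i).abs
    _ ≤ (tuples m n).card • B := Finset.sum_le_card_nsmul _ _ _ fun i _ => hB i
    _ ≤ n ^ m * B := by
        rw [card_tuples, nsmul_eq_mul]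
        gcongr
        exact_mod_cast n.choose_le_pow m

variable [IsProbabilityMeasure ν] {π : Measure Y} {δ : ℝ} {M : ℝ≥0} {h : (Fin m → Y) → ℝ}

lemma IsLLogBounded.integral_abs_uSum_sub_min_le (hh : IsLLogBounded ν π δ M h) (hδ : 0 < δ)
    (h0 : ∀ y, 0 ≤ h y) {T : ℝ} (hT : 1 < T) (n : ℕ) :
    ∫ ω, |uSum (fun y => h y - min (h y) T) n ω| ∂ν ≤ n ^ m * (M / Real.log T ^ (1 + δ)) := by
  refine integral_abs_uSum_le (fun i => ?_) (fun i => ?_) n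
  · exact (hh.integrable_path hδ i).sub ((hh.integrable_path hδ i).inf (integrable_const T))
  · simp only [abs_of_nonneg (sub_nonneg.2 (min_le_left _ T))]
    exact integral_sub_min_le hδ (hh.measurable_path i) (fun _ => h0 _) (hh.lintegral_path_le i) hT

lemma DecouplesAtRate.exists_integral_abs_uSum_div_sub_le [IsProbabilityMeasure π] {ε : ℕ → ℝ≥0}
    (hν : DecouplesAtRate ν π ε) {r : ℝ} (hr : 0 < r)
    (hε : (fun k => (ε k : ℝ)) =O[atTop] fun n : ℕ => (n : ℝ) ^ (-r))
    (hh : IsLLogBounded ν π δ M h) (hδ : 0 < δ) (h0 : ∀ y, 0 ≤ h y) :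
    ∃ s > (0 : ℝ), ∃ C : ℝ, ∀ n : ℕ, n ≠ 0 → ∀ T > (1 : ℝ),
      ∫ ω, |uSum h n ω / n ^ m -
          n.choose m / n ^ m * ∫ y, min (h y) T ∂(Measure.pi fun _ => π)| ∂ν ≤
        C * (T * (n : ℝ) ^ (-s)) + M / Real.log T ^ (1 + δ) := by
  obtain ⟨s, hs, C, hL1⟩ := hν.exists_integral_abs_uSum_sub_le hr hε m
  refine ⟨s, hs, C, fun n hn T hT => ?_⟩
  have hT0 : 0 < T := one_pos.trans hT
  set c := ∫ y, min (h y) T ∂(Measure.pi fun _ => π)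
  have hmin : ∀ y, |min (h y) T| ≤ T := fun y =>
    (abs_of_nonneg (le_min (h0 y) hT0.le)).trans_le (min_le_right _ _)
  have hmini : ∀ i : Fin m → ℕ, Integrable (fun ω : ℕ → Y => min (h fun j => ω (i j)) T) ν :=
    fun i => (hh.integrable_path hδ i).inf (integrable_const T)
  have hbulk : Integrable (fun ω => uSum (fun y => min (h y) T) n ω - n.choose m * c) ν :=
    (integrable_uSum hmini n).sub (integrable_const _)
  have htail : Integrable (uSum (fun y => h y - min (h y) T) n) ν :=
    integrable_uSum (fun i => (hh.integrable_path hδ i).sub (hmini i)) n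
  calc _ = ∫ ω, |(uSum (fun y => min (h y) T) n ω - n.choose m * c +
          uSum (fun y => h y - min (h y) T) n ω)| / n ^ m ∂ν := by
        refine integral_congr_ae (.of_forall fun ω => ?_)
        have hpow : |(n : ℝ) ^ m| = n ^ m := abs_of_nonneg (by positivity)
        simp only [uSum_sub]
        rw [add_comm, sub_add_sub_cancel, mul_comm_div, ← mul_div_assoc, ← sub_div, abs_div, hpow]
    _ ≤ (∫ ω, |uSum (fun y => min (h y) T) n ω - n.choose m * c| ∂ν +
          ∫ ω, |uSum (fun y => h y - min (h y) T) n ω| ∂ν) / n ^ m := by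
        rw [integral_div, ← integral_add hbulk.abs htail.abs]
        exact div_le_div_of_nonneg_right (integral_mono (hbulk.add htail).abs
          (hbulk.abs.add htail.abs) fun _ => abs_add_le _ _) (by positivity)
    _ ≤ (C * T * n ^ m * (n : ℝ) ^ (-s) + n ^ m * (M / Real.log T ^ (1 + δ))) / n ^ m := by
        gcongr
        · exact hL1 n hn T hT0 _ (hh.measurable.min measurable_const) hmin
        · exact hh.integral_abs_uSum_sub_min_le hδ h0 hT n
    _ = C * (T * (n : ℝ) ^ (-s)) + M / Real.log T ^ (1 + δ) := by
        field_simp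

lemma DecouplesAtRate.exists_truncation_summable [IsProbabilityMeasure π] {ε : ℕ → ℝ≥0}
    (hν : DecouplesAtRate ν π ε) {r : ℝ} (hr : 0 < r)
    (hε : (fun k => (ε k : ℝ)) =O[atTop] fun n : ℕ => (n : ℝ) ^ (-r))
    (hh : IsLLogBounded ν π δ M h) (hδ : 0 < δ) (h0 : ∀ y, 0 ≤ h y) {γ : ℝ} (hγ : 1 < γ) :
    ∃ T : ℕ → ℝ, (∀ k, 0 ≤ T k) ∧ Tendsto T atTop atTop ∧
      Summable fun k => ∫ ω, |uSum h ⌊γ ^ k⌋₊ ω / (⌊γ ^ k⌋₊ : ℝ) ^ m -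
        (⌊γ ^ k⌋₊.choose m : ℝ) / (⌊γ ^ k⌋₊ : ℝ) ^ m *
          ∫ y, min (h y) (T k) ∂(Measure.pi fun _ => π)| ∂ν := by
  obtain ⟨s, hs, C, hL1⟩ := hν.exists_integral_abs_uSum_div_sub_le hr hε hh hδ h0
  -- `T k` is of order `⌊γ ^ k⌋₊ ^ (s / 2)`: both error terms are then summable.
  have hτ : 1 < γ ^ (s / 2) := Real.one_lt_rpow hγ (half_pos hs)
  refine ⟨fun k => (γ ^ (s / 2)) ^ (k + 1), fun k => by positivity,
    (tendsto_pow_atTop_atTop_of_one_lt hτ).comp (tendsto_add_atTop_nat 1), ?_⟩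
  refine .of_nonneg_of_le (fun k => integral_nonneg fun _ => abs_nonneg _)
    (fun k => hL1 _ (Nat.floor_pos.2 (one_le_pow₀ hγ.le)).ne' _ (one_lt_pow₀ hτ k.succ_ne_zero)) ?_
  exact ((summable_pow_mul_floor_pow_rpow hγ hs).mul_left C).add
    ((summable_inv_log_pow_rpow hτ hδ).mul_left (M : ℝ))

lemma DecouplesAtRate.tendsto_uSum_floor_pow [IsProbabilityMeasure π] {ε : ℕ → ℝ≥0}
    (hν : DecouplesAtRate ν π ε) {r : ℝ} (hr : 0 < r)
    (hε : (fun k => (ε k : ℝ)) =O[atTop] fun n : ℕ => (n : ℝ) ^ (-r))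
    (hh : IsLLogBounded ν π δ M h) (hδ : 0 < δ) (h0 : ∀ y, 0 ≤ h y) {γ : ℝ} (hγ : 1 < γ) :
    (∀ᵐ ω ∂ν, Tendsto (fun k => uSum h ⌊γ ^ k⌋₊ ω / (⌊γ ^ k⌋₊ : ℝ) ^ m) atTop
      (𝓝 ((m.factorial : ℝ)⁻¹ * ∫ y, h y ∂(Measure.pi fun _ => π)))) ∧
    Tendsto (fun k => (∫ ω, uSum h ⌊γ ^ k⌋₊ ω ∂ν) / (⌊γ ^ k⌋₊ : ℝ) ^ m) atTop
      (𝓝 ((m.factorial : ℝ)⁻¹ * ∫ y, h y ∂(Measure.pi fun _ => π))) := by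
  obtain ⟨T, hT0, hT, hsum⟩ := hν.exists_truncation_summable hr hε hh hδ h0 hγ
  have hfloor : Tendsto (fun k : ℕ => ⌊γ ^ k⌋₊) atTop atTop :=
    tendsto_nat_floor_atTop.comp (tendsto_pow_atTop_atTop_of_one_lt hγ)
  have hcenter := ((tendsto_choose_div_pow m).comp hfloor).mul
    (tendsto_integral_min (hh.integrable_pi hδ) h0 hT0 hT)
  have hint : ∀ k, Integrable (fun ω => uSum h ⌊γ ^ k⌋₊ ω / (⌊γ ^ k⌋₊ : ℝ) ^ m) ν := fun k =>
    (integrable_uSum (hh.integrable_path hδ) _).div_const _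
  refine ⟨ae_tendsto_of_summable_integral_abs_sub hint hcenter hsum, ?_⟩
  simpa only [integral_div] using tendsto_integral_of_summable_integral_abs_sub hint hcenter hsum

end GeometricSubsequence

section Interpolation

lemma tendsto_div_pow_of_monotone {S : ℕ → ℝ} (hS0 : ∀ n, 0 ≤ S n) (hS : Monotone S) {m : ℕ}
    (hm : m ≠ 0) {l : ℝ} (hl : 0 ≤ l) {c : ℕ → ℝ} (hc : ∀ j, 1 < c j)
    (hclim : Tendsto c atTop (𝓝 1))
    (h : ∀ j, Tendsto (fun k : ℕ => S ⌊c j ^ k⌋₊ / (⌊c j ^ k⌋₊ : ℝ) ^ m) atTop (𝓝 l)) :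
    Tendsto (fun n : ℕ => S n / (n : ℝ) ^ m) atTop (𝓝 l) := by
  have hm0 : (0 : ℝ) ≤ (m : ℝ)⁻¹ := by positivity
  have hdiv : ∀ n : ℕ, S n ^ (m : ℝ)⁻¹ / n = (S n / (n : ℝ) ^ m) ^ (m : ℝ)⁻¹ := fun n => by
    rw [Real.div_rpow (hS0 n) (by positivity), Real.pow_rpow_inv_natCast (by positivity) hm]
  have hroot : Tendsto (fun n : ℕ => S n ^ (m : ℝ)⁻¹ / n) atTop (𝓝 (l ^ (m : ℝ)⁻¹)) := by
    refine tendsto_div_of_monotone_of_tendsto_div_floor_pow _ _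
      (fun a b hab => Real.rpow_le_rpow (hS0 a) (hS hab) hm0) c hc hclim fun j => ?_
    simp only [hdiv]
    exact (h j).rpow_const (.inr hm0)
  have hpow := hroot.pow m
  rw [Real.rpow_inv_natCast_pow hl hm] at hpow
  refine hpow.congr fun n => ?_
  rw [hdiv, Real.rpow_inv_natCast_pow (div_nonneg (hS0 n) (by positivity)) hm]

lemma tendsto_inv_choose_mul_of_tendsto_div_pow {S : ℕ → ℝ} {m : ℕ} {l : ℝ}
    (h : Tendsto (fun n : ℕ => S n / (n : ℝ) ^ m) atTop (𝓝 ((m.factorial : ℝ)⁻¹ * l))) :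
    Tendsto (fun n : ℕ => (n.choose m : ℝ)⁻¹ * S n) atTop (𝓝 l) := by
  have hfact : (m.factorial : ℝ)⁻¹ ≠ 0 := by positivity
  have hratio := h.div (tendsto_choose_div_pow m) hfact
  rw [mul_div_cancel_left₀ _ hfact] at hratio
  refine hratio.congr' ?_
  filter_upwards [eventually_gt_atTop 0] with n hn
  have hpow : (n : ℝ) ^ m ≠ 0 := by positivity
  rw [Pi.div_apply, div_div_div_cancel_right₀ hpow, div_eq_inv_mul]

lemma tendsto_inv_choose_mul_of_monotone {S : ℕ → ℝ} (hS0 : ∀ n, 0 ≤ S n) (hS : Monotone S)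
    {m : ℕ} (hm : m ≠ 0) {l : ℝ} (hl : 0 ≤ l) {c : ℕ → ℝ} (hc : ∀ j, 1 < c j)
    (hclim : Tendsto c atTop (𝓝 1))
    (h : ∀ j, Tendsto (fun k : ℕ => S ⌊c j ^ k⌋₊ / (⌊c j ^ k⌋₊ : ℝ) ^ m) atTop
      (𝓝 ((m.factorial : ℝ)⁻¹ * l))) :
    Tendsto (fun n : ℕ => (n.choose m : ℝ)⁻¹ * S n) atTop (𝓝 l) :=
  tendsto_inv_choose_mul_of_tendsto_div_pow
    (tendsto_div_pow_of_monotone hS0 hS hm (by positivity) hc hclim h)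

end Interpolation

section LawOfLargeNumbers

variable {Y : Type*} {m : ℕ} {h : (Fin m → Y) → ℝ}

lemma uSum_nonneg (h0 : ∀ y, 0 ≤ h y) (n : ℕ) (ω : ℕ → Y) : 0 ≤ uSum h n ω :=
  Finset.sum_nonneg fun _ _ => h0 _

lemma uSum_mono (h0 : ∀ y, 0 ≤ h y) (ω : ℕ → Y) : Monotone fun n => uSum h n ω :=
  fun _ _ hn => Finset.sum_le_sum_of_subset_of_nonneg (tuples_mono m hn) fun _ _ _ => h0 _

variable [MeasurableSpace Y] {ν : Measure (ℕ → Y)} [IsProbabilityMeasure ν] {π : Measure Y}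
  [IsProbabilityMeasure π] {ε : ℕ → ℝ≥0} {r δ : ℝ} {M : ℝ≥0}

lemma DecouplesAtRate.tendsto_uSum_of_nonneg (hν : DecouplesAtRate ν π ε) (hr : 0 < r)
    (hε : (fun k => (ε k : ℝ)) =O[atTop] fun n : ℕ => (n : ℝ) ^ (-r))
    (hh : IsLLogBounded ν π δ M h) (hδ : 0 < δ) (hm : m ≠ 0) (h0 : ∀ y, 0 ≤ h y) :
    (∀ᵐ ω ∂ν, Tendsto (fun n : ℕ => (n.choose m : ℝ)⁻¹ * uSum h n ω) atTop
      (𝓝 (∫ y, h y ∂(Measure.pi fun _ => π)))) ∧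
    Tendsto (fun n : ℕ => (n.choose m : ℝ)⁻¹ * ∫ ω, uSum h n ω ∂ν) atTop
      (𝓝 (∫ y, h y ∂(Measure.pi fun _ => π))) := by
  obtain ⟨c, -, hc, hclim⟩ := exists_seq_strictAnti_tendsto (1 : ℝ)
  have hsub := fun j => hν.tendsto_uSum_floor_pow hr hε hh hδ h0 (hc j)
  have hπ0 : 0 ≤ ∫ y, h y ∂(Measure.pi fun _ => π) := integral_nonneg h0
  constructor
  · filter_upwards [ae_all_iff.2 fun j => (hsub j).1] with ω hω
    exact tendsto_inv_choose_mul_of_monotone (fun n => uSum_nonneg h0 n ω) (uSum_mono h0 ω)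
      hm hπ0 hc hclim hω
  · have hint := integrable_uSum (hh.integrable_path hδ)
    exact tendsto_inv_choose_mul_of_monotone (fun n => integral_nonneg (uSum_nonneg h0 n))
      (fun _ _ hn => integral_mono (hint _) (hint _) fun ω => uSum_mono h0 ω hn)
      hm hπ0 hc hclim fun j => (hsub j).2

theorem DecouplesAtRate.tendsto_uSum (hν : DecouplesAtRate ν π ε) (hr : 0 < r)
    (hε : (fun k => (ε k : ℝ)) =O[atTop] fun n : ℕ => (n : ℝ) ^ (-r))
    (hh : IsLLogBounded ν π δ M h) (hδ : 0 < δ) (hm : m ≠ 0) :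
    (∀ᵐ ω ∂ν, Tendsto (fun n : ℕ => (n.choose m : ℝ)⁻¹ * uSum h n ω) atTop
      (𝓝 (∫ y, h y ∂(Measure.pi fun _ => π)))) ∧
    Tendsto (fun n : ℕ => (n.choose m : ℝ)⁻¹ * ∫ ω, uSum h n ω ∂ν) atTop
      (𝓝 (∫ y, h y ∂(Measure.pi fun _ => π))) := by
  set p : (Fin m → Y) → ℝ := fun y => max (h y) 0
  set q : (Fin m → Y) → ℝ := fun y => max (-h y) 0
  have hpq : h = fun y => p y - q y :=
    funext fun y => (max_zero_sub_max_neg_zero_eq_self (h y)).symm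
  have hp : IsLLogBounded ν π δ M p := hh.mono hδ (hh.measurable.max measurable_const) fun y =>
    (abs_of_nonneg (le_max_right _ _)).trans_le (max_le (le_abs_self _) (abs_nonneg _))
  have hq : IsLLogBounded ν π δ M q := hh.mono hδ (hh.measurable.neg.max measurable_const) fun y =>
    (abs_of_nonneg (le_max_right _ _)).trans_le (max_le (neg_le_abs _) (abs_nonneg _))
  have hlim : ∫ y, h y ∂(Measure.pi fun _ => π) =
      ∫ y, p y ∂(Measure.pi fun _ => π) - ∫ y, q y ∂(Measure.pi fun _ => π) := by
    rw [hpq]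
    exact integral_sub (hp.integrable_pi hδ) (hq.integrable_pi hδ)
  have hmean : ∀ n, ∫ ω, uSum h n ω ∂ν = ∫ ω, uSum p n ω ∂ν - ∫ ω, uSum q n ω ∂ν := fun n => by
    simp only [hpq, uSum_sub]
    exact integral_sub (integrable_uSum (hp.integrable_path hδ) n)
      (integrable_uSum (hq.integrable_path hδ) n)
  obtain ⟨hp_ae, hp_mean⟩ := hν.tendsto_uSum_of_nonneg hr hε hp hδ hm fun _ => le_max_right _ _
  obtain ⟨hq_ae, hq_mean⟩ := hν.tendsto_uSum_of_nonneg hr hε hq hδ hm fun _ => le_max_right _ _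
  rw [hlim]
  constructor
  · filter_upwards [hp_ae, hq_ae] with ω hpω hqω
    refine (hpω.sub hqω).congr fun n => ?_
    rw [← mul_sub, ← uSum_sub, ← hpq]
  · refine (hp_mean.sub hq_mean).congr fun n => ?_
    rw [← mul_sub, hmean]

end LawOfLargeNumbers

end UStatMarkov

theorem theorem2_general {Y : Type*} [MeasurableSpace Y]
    (P : Kernel Y Y) [IsMarkovKernel P] (π : Measure Y) [IsProbabilityMeasure π]
    (V : Y → ℝ) (hV : Measurable V) (hV0 : ∀ y, 0 < V y) (hπ : vMoment π V < ∞) (ρ : ℕ → ℝ)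
    (hP : ∀ x k, tvNorm ((P ^ k) x) π ≤ ENNReal.ofReal (ρ k) * ENNReal.ofReal (V x))
    (r : ℝ) (hr : 0 < r) (hρ : ρ =O[atTop] fun n : ℕ => (n : ℝ) ^ (-r))
    (m : ℕ) (hm : 1 ≤ m) (h : (Fin m → Y) → ℝ) (hmeas : Measurable h)
    (δ : ℝ) (hδ : 0 < δ)
    (hbound : BddAbove (Set.range fun y : Fin m → Y =>
      |h y| * (Real.posLog |h y|) ^ (1 + δ) / ∑ i, V (y i)))
    (μ : Measure Y) [IsProbabilityMeasure μ] (hμ : supMoment P μ V < ∞) :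
    (∀ n, ∀ i ∈ tuples m n, Integrable (fun ω : ℕ → Y => h fun j => ω (i j)) (chainLaw P μ)) ∧
    (∀ᵐ ω ∂(chainLaw P μ), Tendsto (fun n : ℕ => ((n.choose m : ℕ) : ℝ)⁻¹ *
        ∑ i ∈ tuples m n,
          (h (fun j => ω (i j)) - ∫ ω', h (fun j => ω' (i j)) ∂(chainLaw P μ)))
      atTop (𝓝 0)) ∧
    Integrable h (Measure.pi fun _ : Fin m => π) ∧
    Tendsto (fun n : ℕ => ((n.choose m : ℕ) : ℝ)⁻¹ *
        ∑ i ∈ tuples m n, ∫ ω, h (fun j => ω (i j)) ∂(chainLaw P μ))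
      atTop (𝓝 (∫ y, h y ∂(Measure.pi fun _ : Fin m => π))) := by
  obtain ⟨M, hM⟩ := exists_isLLogBounded_chainLaw hV hV0 hπ hμ hm hmeas hbound
  have hrate : (fun k => (((ρ k).toNNReal * (supMoment P μ V).toNNReal : ℝ≥0) : ℝ)) =O[atTop]
      fun n : ℕ => (n : ℝ) ^ (-r) := by
    simp only [NNReal.coe_mul, mul_comm _ ((supMoment P μ V).toNNReal : ℝ)]
    refine .const_mul_left ((Asymptotics.isBigO_of_le _ fun k => ?_).trans hρ) _
    rw [Real.coe_toNNReal', Real.norm_of_nonneg (le_max_right _ _)]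
    exact max_le (le_abs_self (ρ k)) (abs_nonneg (ρ k))
  have hint := hM.integrable_path hδ
  obtain ⟨h_ae, h_mean⟩ := (decouplesAtRate_chainLaw hV hμ hP).tendsto_uSum hr hrate hM hδ
    (Nat.one_le_iff_ne_zero.1 hm)
  simp only [integral_uSum hint] at h_mean
  refine ⟨fun _ i _ => hint i, ?_, hM.integrable_pi hδ, h_mean⟩
  filter_upwards [h_ae] with ω hω
  simpa only [uSum, ← mul_sub, ← Finset.sum_sub_distrib, sub_self] using hω.sub h_mean

theorem theorem2 {Y : Type*} [MeasurableSpace Y]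
    (P : Kernel Y Y) [IsMarkovKernel P] (π : Measure Y) (V : Y → ℝ) (ρ : ℕ → ℝ)
    (hA : ErgodicityAssumption P π V ρ)
    (r : ℝ) (hr : 1 < r) (hρ : ρ =O[atTop] fun n : ℕ => (n : ℝ) ^ (-r))
    (m : ℕ) (hm : 1 ≤ m) (h : (Fin m → Y) → ℝ) (hmeas : Measurable h) (hsymm : IsSymmetric h)
    (δ : ℝ) (hδ : 0 < δ)
    (hbound : BddAbove (Set.range fun y : Fin m → Y =>
      |h y| * (Real.posLog |h y|) ^ (1 + δ) / ∑ i, V (y i)))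
    (μ : Measure Y) [IsProbabilityMeasure μ] (hμ : supMoment P μ V < ∞) :
    (∀ n, ∀ i ∈ tuples m n, Integrable (fun ω : ℕ → Y => h fun j => ω (i j)) (chainLaw P μ)) ∧
    (∀ᵐ ω ∂(chainLaw P μ), Tendsto (fun n : ℕ => ((n.choose m : ℕ) : ℝ)⁻¹ *
        ∑ i ∈ tuples m n,
          (h (fun j => ω (i j)) - ∫ ω', h (fun j => ω' (i j)) ∂(chainLaw P μ)))
      atTop (𝓝 0)) ∧
    Integrable h (Measure.pi fun _ : Fin m => π) ∧
    Tendsto (fun n : ℕ => ((n.choose m : ℕ) : ℝ)⁻¹ *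
        ∑ i ∈ tuples m n, ∫ ω, h (fun j => ω (i j)) ∂(chainLaw P μ))
      atTop (𝓝 (∫ y, h y ∂(Measure.pi fun _ : Fin m => π))) := by
  have := hA.isProbabilityMeasure
  exact theorem2_general P π V hA.measurable_V (fun y => one_pos.trans_le (hA.one_le_V y))
    hA.moment_pi _ hA.tvNorm_pow_le r (one_pos.trans hr) (hρ.const_mul_left _) m hm h hmeas δ hδ
    hbound μ hμ
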